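/- Let $u,v\in\mathbb Z$ and let $a,b\ge 1$ be integers. An *integer configuration* consists of the rectangle $R=[u-\tfrac12,\,u-\tfrac12+a]\times[v-\tfrac12,\,v-\tfrac12+b]$, whose rows are the integers $u,\dots,u+a-1$ and whose columns are the integers $v,\dots,v+b-1$, and of $n$ sensors of diameter $1$ at positions $p_1,\dots,p_n\in R\cap\mathbb Z^2$, not necessarily distinct, with $n\ge\max\{a,b\}$. A sensor at position $(i,j)$ is located in row $i$ and in column $j$. A row (column) of $R$ in which no sensor is located is a *row gap* (*column gap*). A sensor at $(i,j)$ is *free* if at least one other sensor is located in row $i$ and at least one other sensor is located in column $j$. A *maximum free set* is a set $M$ of free sensors, of the largest possible cardinality, such that removing all sensors of $M$ at the same time creates no new row gap and no new column gap. **Theorem.** Given an integer configuration with $n$ sensors as input, a maximum free set can be found in $O(n^{3/2})$ time. That is, there are one random access machine program (integer registers and integer arrays with random access; unit cost for each memory access, addition, subtraction, comparison, assignment and branch) and one constant $C$ such that on every integer configuration, given by $n,u,v,a,b$ and the list of sensor positions, the program halts after at most $C\,n^{3/2}$ steps and outputs the indicator vector of a maximum free set. -/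

import Mathlib

namespace WeakBarrier

/-! ### Integer configurations and maximum free sets -/

/-- An integer configuration of `n` sensors of diameter `1`.  The rectangle is
`[u - 1/2, u - 1/2 + a] × [v - 1/2, v - 1/2 + b]` (displaced by `1/2` from the integer grid), so
that its rows are the integers `u, …, u + a - 1` and its columns are `v, …, v + b - 1`.  Sensor `k`
is at the grid point `pos k = (row, column)` of the rectangle; several sensors may share a point.
The sum of the sensor diameters, which is `n`, is at least the longer side of the rectangle. -/
structure IntegerConfiguration (n : ℕ) where
  u : ℤ
  v : ℤ
  a : ℕ
  b : ℕ
  a_pos : 0 < a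
  b_pos : 0 < b
  pos : Fin n → ℤ × ℤ
  row_mem : ∀ k, u ≤ (pos k).1 ∧ (pos k).1 < u + a
  col_mem : ∀ k, v ≤ (pos k).2 ∧ (pos k).2 < v + b
  enough : max a b ≤ n

namespace IntegerConfiguration

variable {n : ℕ} (c : IntegerConfiguration n)

/-- The row in which sensor `k` is located. -/
def row (k : Fin n) : ℤ := (c.pos k).1

/-- The column in which sensor `k` is located. -/
def col (k : Fin n) : ℤ := (c.pos k).2

/-- Row `i` of the rectangle is a row gap when only the sensors in `T` are present. -/
def IsRowGap (T : Finset (Fin n)) (i : ℤ) : Prop :=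
  (c.u ≤ i ∧ i < c.u + c.a) ∧ ∀ k ∈ T, c.row k ≠ i

/-- Column `j` of the rectangle is a column gap when only the sensors in `T` are present. -/
def IsColGap (T : Finset (Fin n)) (j : ℤ) : Prop :=
  (c.v ≤ j ∧ j < c.v + c.b) ∧ ∀ k ∈ T, c.col k ≠ j

/-- Sensor `k` is free: there is another sensor in its row and another sensor in its column. -/
def IsFree (k : Fin n) : Prop :=
  (∃ l, l ≠ k ∧ c.row l = c.row k) ∧ (∃ l, l ≠ k ∧ c.col l = c.col k)

/-- `M` consists of free sensors which can all be removed at the same time without creating a new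
row gap or a new column gap. -/
def IsFreeSet (M : Finset (Fin n)) : Prop :=
  (∀ k ∈ M, c.IsFree k) ∧
  (∀ i, c.IsRowGap Mᶜ i → c.IsRowGap Finset.univ i) ∧
  (∀ j, c.IsColGap Mᶜ j → c.IsColGap Finset.univ j)

/-- `M` is a maximum free set. -/
def IsMaximumFreeSet (M : Finset (Fin n)) : Prop :=
  c.IsFreeSet M ∧ ∀ M', c.IsFreeSet M' → M'.card ≤ M.card

end IntegerConfiguration

/-! ### Programs of a random access machine, with unit-cost step count

The machine has integer registers and integer-valued, randomly accessible arrays.  A program is a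
fixed finite text, so it names only finitely many registers and arrays.  The arithmetic operations
are addition and subtraction only.  Each constant, register access, array access, arithmetic
operation, comparison, assignment and branch costs one unit of time. -/

/-- The contents of the memory. -/
structure Store where
  reg : ℕ → ℤ
  arr : ℕ → ℤ → ℤ

/-- Integer expressions; `get A e` is the entry of array `A` at index `e`. -/
inductive Expr where
  | const (z : ℤ)
  | reg (r : ℕ)
  | get (A : ℕ) (e : Expr)
  | add (e₁ e₂ : Expr)
  | sub (e₁ e₂ : Expr)

namespace Expr

/-- The value of an expression. -/
def eval (s : Store) : Expr → ℤ
  | const z => z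
  | reg r => s.reg r
  | get A e => s.arr A (eval s e)
  | add e₁ e₂ => eval s e₁ + eval s e₂
  | sub e₁ e₂ => eval s e₁ - eval s e₂

/-- The time for the evaluation of an expression. -/
def cost : Expr → ℕ
  | const _ => 1
  | reg _ => 1
  | get _ e => cost e + 1
  | add e₁ e₂ => cost e₁ + cost e₂ + 1
  | sub e₁ e₂ => cost e₁ + cost e₂ + 1

end Expr

/-- Tests. -/
inductive Test where
  | le (e₁ e₂ : Expr)
  | eq (e₁ e₂ : Expr)
  | neg (b : Test)
  | and (b₁ b₂ : Test)

namespace Test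

/-- The truth of a test. -/
def Holds (s : Store) : Test → Prop
  | le e₁ e₂ => e₁.eval s ≤ e₂.eval s
  | eq e₁ e₂ => e₁.eval s = e₂.eval s
  | neg b => ¬ Holds s b
  | and b₁ b₂ => Holds s b₁ ∧ Holds s b₂

/-- The time for the evaluation of a test. -/
def cost : Test → ℕ
  | le e₁ e₂ => e₁.cost + e₂.cost + 1
  | eq e₁ e₂ => e₁.cost + e₂.cost + 1
  | neg b => cost b + 1
  | and b₁ b₂ => cost b₁ + cost b₂ + 1

end Test

/-- Programs: `set r e` assigns `e` to register `r`, `put A i e` assigns `e` to the entry of array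
`A` at index `i`, and `loop b p` repeats `p` as long as `b` holds. -/
inductive Program where
  | skip
  | set (r : ℕ) (e : Expr)
  | put (A : ℕ) (i e : Expr)
  | seq (p q : Program)
  | cond (b : Test) (p q : Program)
  | loop (b : Test) (p : Program)

/-- `Exec p s s' t`: started in the store `s`, the program `p` halts in the store `s'` after exactly
`t` units of time. -/
inductive Exec : Program → Store → Store → ℕ → Prop where
  | skip (s : Store) : Exec Program.skip s s 1
  | set (r : ℕ) (e : Expr) (s : Store) :
      Exec (Program.set r e) s
        { reg := Function.update s.reg r (e.eval s), arr := s.arr } (e.cost + 1)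
  | put (A : ℕ) (i e : Expr) (s : Store) :
      Exec (Program.put A i e) s
        { reg := s.reg
          arr := Function.update s.arr A (Function.update (s.arr A) (i.eval s) (e.eval s)) }
        (i.cost + e.cost + 1)
  | seq {p q : Program} {s s' s'' : Store} {t t' : ℕ} :
      Exec p s s' t → Exec q s' s'' t' → Exec (Program.seq p q) s s'' (t + t')
  | cond_true {b : Test} {p q : Program} {s s' : Store} {t : ℕ} :
      b.Holds s → Exec p s s' t → Exec (Program.cond b p q) s s' (b.cost + 1 + t)
  | cond_false {b : Test} {p q : Program} {s s' : Store} {t : ℕ} :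
      ¬ b.Holds s → Exec q s s' t → Exec (Program.cond b p q) s s' (b.cost + 1 + t)
  | loop_true {b : Test} {p : Program} {s s' s'' : Store} {t t' : ℕ} :
      b.Holds s → Exec p s s' t → Exec (Program.loop b p) s' s'' t' →
        Exec (Program.loop b p) s s'' (b.cost + 1 + t + t')
  | loop_false {b : Test} {p : Program} {s : Store} :
      ¬ b.Holds s → Exec (Program.loop b p) s s (b.cost + 1)

/-- The machine is deterministic: a program has at most one halting run from a given store. -/
theorem Exec.deterministic {p : Program} {s s₁ s₂ : Store} {t₁ t₂ : ℕ}
    (h₁ : Exec p s s₁ t₁) (h₂ : Exec p s s₂ t₂) : s₁ = s₂ ∧ t₁ = t₂ := by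
  induction h₁ generalizing s₂ t₂ with
  | skip s => cases h₂; exact ⟨rfl, rfl⟩
  | set r e s => cases h₂; exact ⟨rfl, rfl⟩
  | put A i e s => cases h₂; exact ⟨rfl, rfl⟩
  | seq _ _ ih₁ ih₂ =>
    cases h₂ with
    | seq a b =>
      obtain ⟨rfl, rfl⟩ := ih₁ a
      obtain ⟨rfl, rfl⟩ := ih₂ b
      exact ⟨rfl, rfl⟩
  | cond_true hb _ ih =>
    cases h₂ with
    | cond_true _ a => obtain ⟨rfl, rfl⟩ := ih a; exact ⟨rfl, rfl⟩
    | cond_false hb' _ => exact absurd hb hb'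
  | cond_false hb _ ih =>
    cases h₂ with
    | cond_true hb' _ => exact absurd hb' hb
    | cond_false _ a => obtain ⟨rfl, rfl⟩ := ih a; exact ⟨rfl, rfl⟩
  | loop_true hb _ _ ih₁ ih₂ =>
    cases h₂ with
    | loop_true _ a b =>
      obtain ⟨rfl, rfl⟩ := ih₁ a
      obtain ⟨rfl, rfl⟩ := ih₂ b
      exact ⟨rfl, rfl⟩
    | loop_false hb' => exact absurd hb hb'
  | loop_false hb =>
    cases h₂ with
    | loop_true hb' _ _ => exact absurd hb' hb
    | loop_false _ => exact ⟨rfl, rfl⟩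

/-- The array, indexed by the integers, with entries `f 0, …, f (n - 1)` and `0` elsewhere. -/
def arrayOf {n : ℕ} (f : Fin n → ℤ) (k : ℤ) : ℤ :=
  if h : 0 ≤ k ∧ k < n then f ⟨k.toNat, by omega⟩ else 0

/-- The store that holds a configuration as input: `n, u, v, a, b` in the registers `0, …, 4`, the
rows of the sensors in array `0` and their columns in array `1`; everything else is `0`. -/
def inputStore {n : ℕ} (c : IntegerConfiguration n) : Store where
  reg
    | 0 => n
    | 1 => c.u
    | 2 => c.v
    | 3 => c.a
    | 4 => c.b
    | _ => 0
  arr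
    | 0 => arrayOf c.row
    | 1 => arrayOf c.col
    | _ => fun _ => 0

/-- The store holds the set `M` of sensors as output: the entries `0, …, n - 1` of array `2` are the
indicator function of `M`. -/
def OutputIs {n : ℕ} (s : Store) (M : Finset (Fin n)) : Prop :=
  ∀ k : Fin n, s.arr 2 ((k : ℕ) : ℤ) = if k ∈ M then 1 else 0

end WeakBarrier

/-!
A set of sensors is free if and only if the remaining sensors still reach every row and every column
that contains a sensor.  So the complement of a maximum free set is a minimum edge cover of the
bipartite multigraph whose vertices are the rows and columns in use and whose edges are the sensors.
By Gallai's argument a minimum edge cover arises from a maximum matching by adding one edge for each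
unmatched vertex (`IsExtension.card_chosen_add_le`, `IsCover.card_add_card_le`); maximality is
certified by a vertex cover that is no larger than the matching.

The matching is found in time `O(n * L)` with `L` about `√n`, in two phases.

* An auction: rows have levels, columns have prices, and an unmatched row takes over a neighbouring
  column whose price equals its level, which raises the price by one.  A row whose neighbours have
  all become more expensive raises its level, and gives up at the level `L`.  Every row scans its
  edges at most `L + 1` times.  At the end each threshold between `1` and `L` yields a vertex cover,
  and averaging their sizes shows that the matching lacks at most `n / L ≤ L` edges
  (`AuctionInv.matchingSize_le_add`).
* At most `L + 1` rounds of a depth-first search for an augmenting path, each of linear time.  The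
  search path is not stored: a row takes over a column at once, the displaced row goes on with the
  search, and it takes the column back when its edges are exhausted.  A round without success leaves
  a vertex cover of the size of the matching (`SearchInv.exists_cover`).

The running times are verified with potentials: `runs_loop` bounds the number of iterations of a loop
by a quantity that every iteration lowers, and `wp` and `maxTime` treat loop-free programs.
-/

namespace WeakBarrier

/-! ### Matchings and vertex covers of a bipartite multigraph -/

/-- The edges of the bipartite multigraph of a configuration are the integers `1, …, n`; edge `e`
joins the row `R e` and the column `C e`.  The integer `0` stands for "no edge". -/
noncomputable def edges (n : ℕ) : Finset ℤ := Finset.Icc 1 n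

theorem mem_edges {n : ℕ} {e : ℤ} : e ∈ edges n ↔ 1 ≤ e ∧ e ≤ n := Finset.mem_Icc

/-- `own` and `asg` describe one matching: `own j` is the matching edge at the column `j`, `asg i`
is the matching edge at the row `i`, and `0` marks the unmatched vertices. -/
structure IsMatching (n : ℕ) (R C own asg : ℤ → ℤ) : Prop where
  own_spec : ∀ j, own j ≠ 0 → own j ∈ edges n ∧ C (own j) = j ∧ asg (R (own j)) = own j
  asg_spec : ∀ i, asg i ≠ 0 → asg i ∈ edges n ∧ R (asg i) = i ∧ own (C (asg i)) = asg i

/-- The number of edges of a matching, counted at the columns. -/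
noncomputable def matchingSize (n : ℕ) (C own : ℤ → ℤ) : ℕ :=
  (((edges n).image C).filter (fun j => own j ≠ 0)).card

/-- The rows `KR` and the columns `KC` form a vertex cover. -/
def IsCover (n : ℕ) (R C : ℤ → ℤ) (KR KC : Finset ℤ) : Prop :=
  ∀ e ∈ edges n, R e ∈ KR ∨ C e ∈ KC

section

variable {n : ℕ} {R C own asg : ℤ → ℤ}

theorem edges_pos {e : ℤ} (h : e ∈ edges n) : 0 < e := by
  rw [mem_edges] at h; omega

theorem card_edges : (edges n).card = n := by simp [edges]

theorem matchingSize_le : matchingSize n C own ≤ n :=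
  (Finset.card_filter_le _ _).trans (Finset.card_image_le.trans card_edges.le)

theorem isMatching_zero : IsMatching n R C (fun _ => 0) (fun _ => 0) :=
  ⟨by simp, by simp⟩

theorem IsMatching.matchingSize_le_cover (h : IsMatching n R C own asg) {KR KC : Finset ℤ}
    (hK : IsCover n R C KR KC) : matchingSize n C own ≤ KR.card + KC.card := by
  set J := ((edges n).image C).filter (fun j => own j ≠ 0) with hJ
  have hown : ∀ j ∈ J, own j ≠ 0 := fun j hj => (Finset.mem_filter.1 hj).2
  have h1 : (J.filter (fun j => j ∈ KC)).card ≤ KC.card :=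
    Finset.card_le_card fun j hj => (Finset.mem_filter.1 hj).2
  have h2 : (J.filter (fun j => ¬ j ∈ KC)).card ≤ KR.card := by
    refine Finset.card_le_card_of_injOn (fun j => R (own j)) ?_ ?_
    · intro j hj
      obtain ⟨hjJ, hjK⟩ := Finset.mem_filter.1 hj
      obtain ⟨he, hC, -⟩ := h.own_spec j (hown j hjJ)
      rcases hK _ he with hr | hc
      · exact hr
      · exact absurd (hC ▸ hc) hjK
    · intro j hj j' hj' hjj
      obtain ⟨-, hC, ha⟩ := h.own_spec j (hown j (Finset.mem_filter.1 hj).1)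
      obtain ⟨-, hC', ha'⟩ := h.own_spec j' (hown j' (Finset.mem_filter.1 hj').1)
      simp only at hjj
      rw [← hC, ← hC', ← ha, ← ha', hjj]
  have h3 := Finset.card_filter_add_card_filter_not (s := J) (fun j => j ∈ KC)
  have h4 : matchingSize n C own = J.card := rfl
  omega

theorem IsMatching.take (h : IsMatching n R C own asg) {e x : ℤ} (he : e ∈ edges n) (hx : R e = x)
    (ha : asg x = 0) (ho : own (C e) = 0) :
    IsMatching n R C (Function.update own (C e) e) (Function.update asg x e) := by
  have he0 := edges_pos he
  obtain ⟨h1, h2⟩ := h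
  constructor <;> intro j hj <;> simp only [Function.update_apply] at * <;> grind

theorem matchingSize_take {e : ℤ} (he : e ∈ edges n) (ho : own (C e) = 0) :
    matchingSize n C (Function.update own (C e) e) = matchingSize n C own + 1 := by
  have he0 := edges_pos he
  unfold matchingSize
  rw [← Finset.card_insert_of_notMem (a := C e) (by simp [ho])]
  congr 1
  ext j
  simp only [Finset.mem_filter, Finset.mem_insert, Function.update_apply, Finset.mem_image]
  grind

/-- The unmatched row `x` takes over the column of `e` from the row that is matched to it. -/
theorem IsMatching.displace (h : IsMatching n R C own asg) {e x : ℤ} (he : e ∈ edges n)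
    (hx : R e = x) (ha : asg x = 0) (ho : own (C e) ≠ 0) :
    IsMatching n R C (Function.update own (C e) e)
      (Function.update (Function.update asg x e) (R (own (C e))) 0) := by
  have he0 := edges_pos he
  obtain ⟨h1, h2⟩ := h
  have h3 := h1 _ ho
  constructor <;> intro j hj <;> simp only [Function.update_apply] at * <;> grind

theorem matchingSize_displace {e : ℤ} (he : e ≠ 0) {j : ℤ} (ho : own j ≠ 0) :
    matchingSize n C (Function.update own j e) = matchingSize n C own := by
  unfold matchingSize
  congr 1
  ext j
  simp only [Finset.mem_filter, Function.update_apply, Finset.mem_image]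
  grind

end

/-! ### Linked lists of the edges of a row -/

/-- `head i` is the last edge of the row `i`, and `nxt e` is the last edge before `e` in the row of
`e`; both are `0` when there is no such edge. -/
structure IsRowList (n : ℕ) (R head nxt : ℤ → ℤ) : Prop where
  head_spec : ∀ i, head i = 0 ∨ (head i ∈ edges n ∧ R (head i) = i)
  le_head : ∀ e ∈ edges n, e ≤ head (R e)
  nxt_spec : ∀ e ∈ edges n, nxt e = 0 ∨ (nxt e ∈ edges n ∧ R (nxt e) = R e)
  nxt_lt : ∀ e ∈ edges n, nxt e < e
  le_nxt : ∀ e ∈ edges n, ∀ e' ∈ edges n, R e' = R e → e' < e → e' ≤ nxt e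

/-- The number of edges that are still ahead of the scan pointers `cur` of their rows. -/
noncomputable def pending (n : ℕ) (R cur : ℤ → ℤ) : ℕ :=
  ((edges n).filter (fun e => e ≤ cur (R e))).card

theorem pending_le {n : ℕ} {R cur : ℤ → ℤ} : pending n R cur ≤ n :=
  (Finset.card_filter_le _ _).trans card_edges.le

theorem IsRowList.pending_advance {n : ℕ} {R head nxt cur : ℤ → ℤ} (h : IsRowList n R head nxt)
    {e x : ℤ} (he : e ∈ edges n) (hx : R e = x) (hc : cur x = e) :
    pending n R (Function.update cur x (nxt e)) < pending n R cur := by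
  have h1 := h.nxt_lt e he
  refine Finset.card_lt_card ⟨fun e' => ?_, fun hs => ?_⟩
  · simp only [Finset.mem_filter, Function.update_apply]
    grind
  · have := hs (Finset.mem_filter.2 ⟨he, by rw [hx, hc]⟩)
    simp [hx] at this
    omega

/-- Every entry of `cur` is `0` or an edge of the row it belongs to. -/
def IsRowPointer (n : ℕ) (R cur : ℤ → ℤ) : Prop :=
  ∀ i, cur i = 0 ∨ (cur i ∈ edges n ∧ R (cur i) = i)

theorem IsRowPointer.advance {n : ℕ} {R : ℤ → ℤ} {head nxt cur : ℤ → ℤ} {x : ℤ}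
    (h : IsRowPointer n R cur)
    (hl : IsRowList n R head nxt) (hc : cur x ≠ 0) :
    IsRowPointer n R (Function.update cur x (nxt (cur x))) := by
  intro i
  have h1 := h i
  have h2 := (h x).resolve_left hc
  have h3 := hl.nxt_spec _ h2.1
  simp only [Function.update_apply]; grind

/-! ### The auction -/

/-- The state of the auction.  Every row has a level `d`, every column has a price `p`, and the row
`x` looks for a column whose price is its level.  All neighbours of a row cost at least the level
of the row, and those which its scan pointer `cur` has passed cost more.  The rows of the edges
`1, …, k` are settled, that is, matched or raised to the level `L`, with the possible exception
of `x`; once `k` exceeds `n`, all rows are settled and `x` is meaningless. -/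
structure AuctionInv (n : ℕ) (R C own asg cur d p : ℤ → ℤ) (L k x : ℤ) : Prop where
  matching : IsMatching n R C own asg
  price : ∀ e ∈ edges n, d (R e) ≤ p (C e)
  scanned : ∀ e ∈ edges n, cur (R e) < e → d (R e) + 1 ≤ p (C e)
  cur_spec : IsRowPointer n R cur
  own_price : ∀ j, own j ≠ 0 → p j = d (R (own j)) + 1
  free_price : ∀ j, own j = 0 → p j = 0
  settled : ∀ e ∈ edges n, e ≤ k → (asg (R e) ≠ 0 ∨ L ≤ d (R e)) ∨ (k ≤ n ∧ R e = x)
  row_mem : k ≤ n → ∃ e ∈ edges n, R e = x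

/-- The potential that bounds the number of remaining steps of the auction. -/
noncomputable def auctionPotential (n : ℕ) (R cur d : ℤ → ℤ) (L k : ℤ) : ℕ :=
  2 * ∑ e ∈ edges n, (L - d (R e)).toNat + pending n R cur + (n + 1 - k).toNat

section

variable {n : ℕ} {R C own asg cur d p head nxt : ℤ → ℤ} {L k x : ℤ}

theorem AuctionInv.init (hl : IsRowList n R head nxt) (hn : 0 < n) :
    AuctionInv n R C (fun _ => 0) (fun _ => 0) head (fun _ => 0) (fun _ => 0) L 1 (R 1) where
  matching := isMatching_zero
  price := by simp
  scanned e he h := by have := hl.le_head e he; omega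
  cur_spec := hl.head_spec
  own_price := by simp
  free_price := by simp
  settled e he h := by
    have : e = 1 := by rw [mem_edges] at he; omega
    subst this
    exact Or.inr ⟨by omega, rfl⟩
  row_mem _ := ⟨1, by rw [mem_edges]; omega, rfl⟩

theorem AuctionInv.next (h : AuctionInv n R C own asg cur d p L k x)
    (hx : ¬ (asg x = 0 ∧ d x < L)) (hk : 1 ≤ k ∧ k ≤ n) :
    AuctionInv n R C own asg cur d p L (k + 1) (R (k + 1)) where
  matching := h.matching
  price := h.price
  scanned := h.scanned
  cur_spec := h.cur_spec
  own_price := h.own_price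
  free_price := h.free_price
  settled e he hek := by
    have := h.settled e he
    have := mem_edges.1 he
    grind
  row_mem hk' := ⟨k + 1, by rw [mem_edges]; omega, rfl⟩

theorem AuctionInv.raise (h : AuctionInv n R C own asg cur d p L k x)
    (hl : IsRowList n R head nxt) (ha : asg x = 0) (hc : cur x = 0) :
    AuctionInv n R C own asg (Function.update cur x (head x)) (Function.update d x (d x + 1))
      p L k x := by
  obtain ⟨h1, h2, h3, h4, h5, h6, h7, h8⟩ := h
  have h9 := h1.own_spec
  have h10 := hl.le_head
  have h11 := hl.head_spec
  refine ⟨h1, ?_, ?_, ?_, ?_, h6, ?_, h8⟩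
  · intro e he
    have := edges_pos he
    simp only [Function.update_apply]; grind
  · intro e he
    have := edges_pos he
    simp only [Function.update_apply]; grind
  · intro i
    have := h4 i
    simp only [Function.update_apply]; grind
  · intro j hj
    simp only [Function.update_apply]; grind
  · intro e he
    simp only [Function.update_apply]; grind

theorem AuctionInv.scan_spec (h : AuctionInv n R C own asg cur d p L k x) (hc : cur x ≠ 0) :
    cur x ∈ edges n ∧ R (cur x) = x := (h.cur_spec x).resolve_left hc

theorem AuctionInv.skip (h : AuctionInv n R C own asg cur d p L k x)
    (hl : IsRowList n R head nxt) (hc : cur x ≠ 0) (hp : p (C (cur x)) ≠ d x) :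
    AuctionInv n R C own asg (Function.update cur x (nxt (cur x))) d p L k x := by
  have hs := h.scan_spec hc
  obtain ⟨h1, h2, h3, h4, h5, h6, h7, h8⟩ := h
  have h9 := hl.nxt_spec _ hs.1
  have h10 := hl.le_nxt _ hs.1
  refine ⟨h1, h2, ?_, ?_, h5, h6, h7, h8⟩
  · intro e he
    have := h2 e he
    simp only [Function.update_apply]; grind
  · intro i
    have := h4 i
    simp only [Function.update_apply]; grind

theorem AuctionInv.take (h : AuctionInv n R C own asg cur d p L k x)
    (hl : IsRowList n R head nxt) (ha : asg x = 0) (hc : cur x ≠ 0)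
    (hp : p (C (cur x)) = d x) (ho : own (C (cur x)) = 0) :
    AuctionInv n R C (Function.update own (C (cur x)) (cur x)) (Function.update asg x (cur x))
      (Function.update cur x (nxt (cur x))) d
      (Function.update p (C (cur x)) (p (C (cur x)) + 1)) L k x := by
  have hs := h.scan_spec hc
  obtain ⟨h1, h2, h3, h4, h5, h6, h7, h8⟩ := h
  have h9 := hl.nxt_spec _ hs.1
  have h10 := hl.le_nxt _ hs.1
  refine ⟨h1.take hs.1 hs.2 ha ho, ?_, ?_, ?_, ?_, ?_, ?_, h8⟩
  · intro e he
    have := h2 e he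
    simp only [Function.update_apply]; grind
  · intro e he
    have := h2 e he
    simp only [Function.update_apply]; grind
  · intro i
    have := h4 i
    simp only [Function.update_apply]; grind
  · intro j
    simp only [Function.update_apply]; grind
  · intro j
    simp only [Function.update_apply]; grind
  · intro e he
    simp only [Function.update_apply]; grind

theorem AuctionInv.displace (h : AuctionInv n R C own asg cur d p L k x)
    (hl : IsRowList n R head nxt) (hk : k ≤ n) (ha : asg x = 0) (hc : cur x ≠ 0)
    (hp : p (C (cur x)) = d x) (ho : own (C (cur x)) ≠ 0) :
    AuctionInv n R C (Function.update own (C (cur x)) (cur x))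
      (Function.update (Function.update asg x (cur x)) (R (own (C (cur x)))) 0)
      (Function.update cur x (nxt (cur x))) d
      (Function.update p (C (cur x)) (p (C (cur x)) + 1)) L k (R (own (C (cur x)))) := by
  have hs := h.scan_spec hc
  obtain ⟨h1, h2, h3, h4, h5, h6, h7, h8⟩ := h
  have h9 := hl.nxt_spec _ hs.1
  have h10 := hl.le_nxt _ hs.1
  refine ⟨h1.displace hs.1 hs.2 ha ho, ?_, ?_, ?_, ?_, ?_, ?_,
    fun _ => ⟨_, (h1.own_spec _ ho).1, rfl⟩⟩
  · intro e he
    have := h2 e he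
    simp only [Function.update_apply]; grind
  · intro e he
    have := h2 e he
    simp only [Function.update_apply]; grind
  · intro i
    have := h4 i
    simp only [Function.update_apply]; grind
  · intro j
    simp only [Function.update_apply]; grind
  · intro j
    simp only [Function.update_apply]; grind
  · intro e he
    have := h7 e he
    simp only [Function.update_apply]; grind

theorem auctionPotential_next (hk : k ≤ n) :
    auctionPotential n R cur d L (k + 1) < auctionPotential n R cur d L k := by
  unfold auctionPotential
  omega

/-- Raising the level of `x` makes the scan of its `m ≥ 1` edges start again, which costs at most
`m`, and gains `2 * m`. -/
theorem AuctionInv.potential_raise (h : AuctionInv n R C own asg cur d p L k x) (hk : k ≤ n)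
    (hd : d x < L) :
    auctionPotential n R (Function.update cur x (head x)) (Function.update d x (d x + 1)) L k <
      auctionPotential n R cur d L k := by
  unfold auctionPotential
  obtain ⟨e₀, he₀, hx⟩ := h.row_mem hk
  set S := (edges n).filter (fun e => R e = x)
  have hS : 0 < S.card := Finset.card_pos.2 ⟨e₀, Finset.mem_filter.2 ⟨he₀, hx⟩⟩
  have h1 : pending n R (Function.update cur x (head x)) ≤ pending n R cur + S.card := by
    refine (Finset.card_le_card ?_).trans (Finset.card_union_le _ _)
    intro e
    simp only [S, Finset.mem_filter, Finset.mem_union, Function.update_apply]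
    grind
  have h2 : ∑ e ∈ edges n, (L - Function.update d x (d x + 1) (R e)).toNat + S.card =
      ∑ e ∈ edges n, (L - d (R e)).toNat := by
    rw [Finset.card_filter, ← Finset.sum_add_distrib]
    refine Finset.sum_congr rfl fun e _ => ?_
    simp only [Function.update_apply]
    split_ifs with hr
    · rw [hr]; omega
    · omega
  omega

theorem AuctionInv.potential_advance (h : AuctionInv n R C own asg cur d p L k x)
    (hl : IsRowList n R head nxt) (hc : cur x ≠ 0) :
    auctionPotential n R (Function.update cur x (nxt (cur x))) d L k <
      auctionPotential n R cur d L k := by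
  have := hl.pending_advance (h.scan_spec hc).1 (h.scan_spec hc).2 rfl
  unfold auctionPotential
  omega

theorem auctionPotential_init (L : ℕ) :
    auctionPotential n R cur (fun _ => 0) L 1 ≤ n * (2 * L + 2) := by
  have := pending_le (n := n) (R := R) (cur := cur)
  unfold auctionPotential
  simp only [sub_zero, Int.toNat_natCast, Finset.sum_const, card_edges, smul_eq_mul]
  have h2 : ((n : ℤ) + 1 - 1).toNat = n := by omega
  rw [h2]
  nlinarith

/-- For every threshold `t` the rows below the level `t` and the columns of price at least `t` form
a vertex cover; its size exceeds that of the matching only by the number of matching edges whose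
row has level exactly `t - 1`.  Averaging over `t = 1, …, L` shows that a matching has at most
`n / L ≤ L` edges more than the one found by the auction. -/
theorem AuctionInv.matchingSize_le_add {L : ℕ} (h : AuctionInv n R C own asg cur d p L k x)
    (hk : n < k) (hL : n ≤ L * L) (hn : 0 < n) {own' asg' : ℤ → ℤ}
    (h' : IsMatching n R C own' asg') :
    matchingSize n C own' ≤ matchingSize n C own + L := by
  have hset : ∀ e ∈ edges n, asg (R e) ≠ 0 ∨ (L : ℤ) ≤ d (R e) := fun e he =>
    (h.settled e he (by rw [mem_edges] at he; omega)).resolve_right (by omega)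
  set J := ((edges n).image C).filter (fun j => own j ≠ 0) with hJ
  have hJc : matchingSize n C own = J.card := rfl
  have hcov : ∀ t ∈ Finset.Icc (1 : ℤ) L, matchingSize n C own' ≤
      J.card + (J.filter (fun j => p j = t)).card := by
    intro t ht
    rw [Finset.mem_Icc] at ht
    set KR := ((edges n).image R).filter (fun i => d i < t) with hKR
    set KC := ((edges n).image C).filter (fun j => t ≤ p j) with hKC
    have hK : IsCover n R C KR KC := by
      intro e he
      have := h.price e he
      by_cases hd : d (R e) < t
      · exact Or.inl (Finset.mem_filter.2 ⟨Finset.mem_image_of_mem _ he, hd⟩)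
      · exact Or.inr (Finset.mem_filter.2 ⟨Finset.mem_image_of_mem _ he, by omega⟩)
    have h1 : KR.card ≤ (J.filter (fun j => p j ≤ t)).card := by
      refine Finset.card_le_card_of_injOn (fun i => C (asg i)) ?_ ?_
      · intro i hi
        obtain ⟨hi, hd⟩ := Finset.mem_filter.1 hi
        obtain ⟨e, he, rfl⟩ := Finset.mem_image.1 hi
        have ha : asg (R e) ≠ 0 := (hset e he).resolve_right (by omega)
        obtain ⟨ha1, ha2, ha3⟩ := h.matching.asg_spec _ ha
        have ho : own (C (asg (R e))) ≠ 0 := by rw [ha3]; exact ha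
        have hp := h.own_price _ ho
        rw [ha3, ha2] at hp
        simp only [Finset.coe_filter, Finset.mem_image, Set.mem_ofPred_eq, hJ, Finset.mem_filter]
        exact ⟨⟨⟨_, ha1, rfl⟩, ho⟩, by omega⟩
      · intro i hi i' hi' hii
        have key : ∀ i ∈ KR, asg i ≠ 0 := by
          intro i hi
          obtain ⟨hi, hd⟩ := Finset.mem_filter.1 hi
          obtain ⟨e, he, rfl⟩ := Finset.mem_image.1 hi
          exact (hset e he).resolve_right (by omega)
        obtain ⟨-, ha2, ha3⟩ := h.matching.asg_spec _ (key i hi)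
        obtain ⟨-, hb2, hb3⟩ := h.matching.asg_spec _ (key i' hi')
        simp only at hii
        rw [← ha2, ← hb2, ← ha3, ← hb3, hii]
    have h2 : KC.card ≤ (J.filter (fun j => t ≤ p j)).card := by
      refine Finset.card_le_card fun j hj => ?_
      obtain ⟨hj, hp⟩ := Finset.mem_filter.1 hj
      refine Finset.mem_filter.2 ⟨Finset.mem_filter.2 ⟨hj, fun ho => ?_⟩, hp⟩
      have := h.free_price j ho
      omega
    have h3 := Finset.card_union_add_card_inter (J.filter (fun j => p j ≤ t))
      (J.filter (fun j => t ≤ p j))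
    have h4 : (J.filter (fun j => p j ≤ t) ∪ J.filter (fun j => t ≤ p j)).card ≤ J.card :=
      Finset.card_le_card (Finset.union_subset (Finset.filter_subset _ _) (Finset.filter_subset _ _))
    have h5 : J.filter (fun j => p j ≤ t) ∩ J.filter (fun j => t ≤ p j) =
        J.filter (fun j => p j = t) := by
      ext j
      simp only [Finset.mem_inter, Finset.mem_filter]
      grind
    rw [h5] at h3
    have := h'.matchingSize_le_cover hK
    omega
  have hsum := Finset.sum_le_sum hcov
  rw [Finset.sum_add_distrib, Finset.sum_const, Finset.sum_const] at hsum
  have hfib : ∑ t ∈ Finset.Icc (1 : ℤ) L, (J.filter (fun j => p j = t)).card ≤ J.card := by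
    rw [← Finset.card_biUnion]
    · exact Finset.card_le_card (Finset.biUnion_subset.2 fun _ _ => Finset.filter_subset _ _)
    · intro t _ t' _ htt
      rw [Function.onFun, Finset.disjoint_left]
      intro j hj hj'
      exact htt ((Finset.mem_filter.1 hj).2.symm.trans (Finset.mem_filter.1 hj').2)
  have hJn : J.card ≤ n := hJc ▸ matchingSize_le
  simp only [Int.card_Icc, smul_eq_mul] at hsum
  have hLL : ((L : ℤ) + 1 - 1).toNat = L := by omega
  rw [hLL] at hsum
  have hL0 : 0 < L := Nat.pos_of_ne_zero (by rintro rfl; omega)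
  rw [hJc]
  refine Nat.le_of_mul_le_mul_left ?_ hL0
  nlinarith

end

/-! ### The search for an augmenting path -/

/-- The displaced row `x` and the rows `tail` form the current search path, from its end back to the
root: each row has lost its column to the next one, and `back` remembers its former edge there. -/
def IsStack (n : ℕ) (R C own asg vis back : ℤ → ℤ) (root : ℤ) : ℤ → List ℤ → Prop
  | x, [] => x = root
  | x, y :: tail => back x ∈ edges n ∧ R (back x) = x ∧ own (C (back x)) = asg y ∧
      vis (C (back x)) ≠ 0 ∧ IsStack n R C own asg vis back root y tail

/-- The state of a round of the search.  The unmatched row `x` takes over columns not visited in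
this round; a row whose edges have all been scanned takes its former column back.  Every visited
column is matched to an exhausted row or to a row of `tail`. -/
structure SearchInv (n : ℕ) (R C own asg cur vis back : ℤ → ℤ) (k x : ℤ) (tail : List ℤ) :
    Prop where
  matching : IsMatching n R C own asg
  scanned : ∀ e ∈ edges n, cur (R e) < e → vis (C e) ≠ 0
  cur_spec : IsRowPointer n R cur
  vis_own : ∀ e ∈ edges n, vis (C e) ≠ 0 → own (C e) ≠ 0 ∧
    (cur (R (own (C e))) = 0 ∨ R (own (C e)) ∈ tail)
  nodup : tail.Nodup
  tail_vis : ∀ y ∈ tail, asg y ≠ 0 ∧ vis (C (asg y)) ≠ 0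
  stack : IsStack n R C own asg vis back (R k) x tail
  free : tail ≠ [] → asg x = 0
  done : ∀ e ∈ edges n, e ≤ k → asg (R e) = 0 → cur (R e) = 0 ∨ (k ≤ n ∧ R e = x)
  finished : n < k → tail = []

/-- The potential that bounds the number of remaining steps of a round. -/
noncomputable def searchPotential (n : ℕ) (R cur : ℤ → ℤ) (k : ℤ) (tail : List ℤ) : ℕ :=
  2 * pending n R cur + tail.length + (n + 1 - k).toNat

section

variable {n : ℕ} {R C own asg cur vis back own' asg' vis' back' head nxt : ℤ → ℤ}
  {k x y root : ℤ} {tail : List ℤ}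

theorem IsStack.congr (h : IsStack n R C own asg vis back root x tail)
    (hb : ∀ z ∈ x :: tail, back' z = back z) (hv : ∀ j, vis j ≠ 0 → vis' j ≠ 0)
    (ho : ∀ z ∈ tail, ∀ j, vis j ≠ 0 → own j = asg z → own' j = asg' z) :
    IsStack n R C own' asg' vis' back' root x tail := by
  induction tail generalizing x with
  | nil => exact h
  | cons y t ih =>
    obtain ⟨h1, h2, h3, h4, h5⟩ := h
    have hx := hb x (by simp)
    refine ⟨hx ▸ h1, by rw [hx]; exact h2, ?_, ?_, ?_⟩
    · rw [hx]; exact ho y (by simp) _ h4 h3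
    · rw [hx]; exact hv _ h4
    · exact ih h5 (fun z hz => hb z (List.mem_cons_of_mem _ hz))
        (fun z hz => ho z (List.mem_cons_of_mem _ hz))

theorem IsStack.eq_root_or_mem (h : IsStack n R C own asg vis back root x tail) :
    tail = [] ∧ x = root ∨ root ∈ tail := by
  induction tail generalizing x with
  | nil => exact Or.inl ⟨rfl, h⟩
  | cons y t ih =>
    rcases ih h.2.2.2.2 with ⟨-, h'⟩ | h'
    · exact Or.inr (by simp [h'])
    · exact Or.inr (List.mem_cons_of_mem _ h')

theorem SearchInv.init (h : IsMatching n R C own asg) (hl : IsRowList n R head nxt)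
    (hc : IsRowPointer n R cur)
    (hh : ∀ e ∈ edges n, cur (R e) = head (R e)) (hv : ∀ e ∈ edges n, vis (C e) = 0)
    (hn : 0 < n) : SearchInv n R C own asg cur vis back 1 (R 1) [] where
  matching := h
  scanned e he h := by
    have := hl.le_head e he
    rw [hh e he] at h
    omega
  cur_spec := hc
  vis_own e he h := absurd (hv e he) h
  nodup := List.nodup_nil
  tail_vis := by simp
  stack := rfl
  free := by simp
  done e he h _ := by
    have : e = 1 := by rw [mem_edges] at he; omega
    subst this
    exact Or.inr ⟨by omega, rfl⟩
  finished _ := rfl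

theorem SearchInv.tail_eq_nil (h : SearchInv n R C own asg cur vis back k x tail)
    (hx : asg x ≠ 0 ∨ x = R k) : tail = [] := by
  by_contra ht
  have ha := h.free ht
  rcases h.stack.eq_root_or_mem with h' | h'
  · exact ht h'.1
  · have := (h.tail_vis _ h').1
    grind

theorem SearchInv.next (h : SearchInv n R C own asg cur vis back k x tail)
    (hx : asg x ≠ 0 ∨ (cur x = 0 ∧ x = R k)) :
    SearchInv n R C own asg cur vis back (k + 1) (R (k + 1)) [] := by
  have ht := h.tail_eq_nil (hx.imp_right And.right)
  subst ht
  obtain ⟨h1, h2, h3, h4, h5, h6, h7, h8, h9, h10⟩ := h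
  refine ⟨h1, h2, h3, h4, h5, h6, rfl, by simp, ?_, fun _ => rfl⟩
  intro e he hk ha
  have h11 := h9 e he
  have h12 := mem_edges.1 he
  grind

theorem SearchInv.scan_spec (h : SearchInv n R C own asg cur vis back k x tail) (hc : cur x ≠ 0) :
    cur x ∈ edges n ∧ R (cur x) = x := (h.cur_spec x).resolve_left hc

theorem SearchInv.skip (h : SearchInv n R C own asg cur vis back k x tail)
    (hl : IsRowList n R head nxt) (hk : k ≤ n) (hc : cur x ≠ 0)
    (hv : vis (C (cur x)) ≠ 0) :
    SearchInv n R C own asg (Function.update cur x (nxt (cur x))) vis back k x tail := by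
  have hs := h.scan_spec hc
  obtain ⟨h1, h2, h3, h4, h5, h6, h7, h8, h9, h10⟩ := h
  have h11 := hl.nxt_spec _ hs.1
  have h12 := hl.le_nxt _ hs.1
  have h13 := h1.own_spec
  refine ⟨h1, ?_, ?_, ?_, h5, h6, h7, h8, ?_, h10⟩
  · intro e he
    have := h2 e he
    clear h2 h3 h4 h5 h6 h7 h8 h9 h10 h13
    simp only [Function.update_apply]; grind
  · intro i
    have := h3 i
    clear h2 h3 h4 h5 h6 h7 h8 h9 h10 h13
    simp only [Function.update_apply]; grind
  · intro e he
    have := h4 e he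
    have := h13 (C e)
    clear h2 h3 h4 h5 h6 h7 h8 h9 h10 h13
    simp only [Function.update_apply]; grind
  · intro e he
    have := h9 e he
    clear h2 h3 h4 h5 h6 h7 h8 h9 h10 h13
    simp only [Function.update_apply]; grind

/-- The unmatched row `x` takes over an unvisited column; the row that owned it becomes the end of
the search path. -/
theorem SearchInv.push (h : SearchInv n R C own asg cur vis back k x tail)
    (hl : IsRowList n R head nxt) (hk : k ≤ n) (ha : asg x = 0) (hc : cur x ≠ 0)
    (hv : vis (C (cur x)) = 0) (ho : own (C (cur x)) ≠ 0) :
    SearchInv n R C (Function.update own (C (cur x)) (cur x))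
      (Function.update (Function.update asg x (cur x)) (R (own (C (cur x)))) 0)
      (Function.update cur x (nxt (cur x))) (Function.update vis (C (cur x)) 1)
      (Function.update back (R (own (C (cur x)))) (own (C (cur x)))) k
      (R (own (C (cur x)))) (x :: tail) := by
  have hs := h.scan_spec hc
  obtain ⟨h1, h2, h3, h4, h5, h6, h7, h8, h9, h10⟩ := h
  have h11 := hl.nxt_spec _ hs.1
  have h12 := hl.le_nxt _ hs.1
  have h13 := h1.own_spec
  have hf := h13 _ ho
  have hxf : R (own (C (cur x))) ≠ x := by intro hxf; rw [hxf] at hf; exact ho (hf.2.2 ▸ ha)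
  have hft : R (own (C (cur x))) ∉ tail := by
    intro hm
    have := (h6 _ hm).2
    rw [hf.2.2, hf.2.1] at this
    exact this hv
  have hxt : x ∉ tail := fun hm => (h6 _ hm).1 ha
  refine ⟨h1.displace hs.1 hs.2 ha ho, ?_, ?_, ?_, List.nodup_cons.2 ⟨hxt, h5⟩, ?_, ?_, ?_, ?_, ?_⟩
  · intro e he
    have := h2 e he
    clear h2 h3 h4 h5 h6 h7 h8 h9 h10 h13
    simp only [Function.update_apply]; grind
  · intro i
    have := h3 i
    clear h2 h3 h4 h5 h6 h7 h8 h9 h10 h13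
    simp only [Function.update_apply]; grind
  · intro e he
    have := h4 e he
    have := h13 (C e)
    clear h2 h3 h4 h5 h6 h7 h8 h9 h10 h13
    simp only [Function.update_apply, List.mem_cons]; grind
  · intro y hy
    rcases List.mem_cons.1 hy with rfl | hy
    · simp [hxf.symm, hc]
    · have := h6 y hy
      simp only [Function.update_apply]; grind
  · refine ⟨?_, ?_, ?_, ?_, h7.congr ?_ ?_ ?_⟩
    · simpa using hf.1
    · simp
    · simp [hf.2.1, hxf.symm]
    · simp [hf.2.1]
    · intro z hz
      have : z ≠ R (own (C (cur x))) := by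
        rintro rfl
        rcases List.mem_cons.1 hz with hz | hz
        · exact hxf hz
        · exact hft hz
      simp [this]
    · intro j hj
      simp only [Function.update_apply]; grind
    · intro z hz j hj hjz
      have hjC : j ≠ C (cur x) := by rintro rfl; exact hj hv
      have hz1 : z ≠ R (own (C (cur x))) := by rintro rfl; exact hft hz
      have hz2 : z ≠ x := by rintro rfl; exact hxt hz
      simp [hjC, hz1, hz2, hjz]
  · simp
  · intro e he
    have := h9 e he
    clear h2 h3 h4 h5 h6 h7 h8 h9 h10 h13
    simp only [Function.update_apply]; grind
  · intro hk'; omega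

/-- The exhausted row `x` takes its former column back from the row that displaced it. -/
theorem SearchInv.pop (h : SearchInv n R C own asg cur vis back k x tail)
    (ha : asg x = 0) (hc : cur x = 0) (hx : x ≠ R k) :
    back x ∈ edges n ∧ own (C (back x)) ≠ 0 ∧ ∃ t, tail = R (own (C (back x))) :: t ∧
    SearchInv n R C (Function.update own (C (back x)) (back x))
      (Function.update (Function.update asg x (back x)) (R (own (C (back x)))) 0)
      cur vis back k (R (own (C (back x)))) t := by
  obtain ⟨h1, h2, h3, h4, h5, h6, h7, h8, h9, h10⟩ := h
  cases tail with
  | nil => exact absurd h7 hx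
  | cons y t =>
  obtain ⟨hb, hbx, hbo, hbv, h7⟩ := h7
  have hy := h6 y (by simp)
  have hxt : x ∉ y :: t := fun hm => (h6 _ hm).1 ha
  have ho : own (C (back x)) ≠ 0 := hbo ▸ hy.1
  have hRy : R (own (C (back x))) = y := by rw [hbo]; exact (h1.asg_spec y hy.1).2.1
  have hyt := List.nodup_cons.1 h5
  have hb0 := edges_pos hb
  have hf := h1.own_spec _ ho
  have h13 := h1.own_spec
  have h14 := h1.asg_spec
  refine ⟨hb, ho, t, by rw [hRy], h1.displace hb hbx ha ho, h2, h3, ?_, hyt.2, ?_, ?_, ?_, ?_, ?_⟩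
  · intro e he
    have := h4 e he
    have := h13 (C e)
    clear h2 h3 h4 h5 h6 h7 h8 h9 h10 h13
    simp only [Function.update_apply, List.mem_cons] at *; grind
  · intro z hz
    have := h6 z (List.mem_cons_of_mem _ hz)
    simp only [Function.update_apply]; grind
  · rw [hRy]
    refine h7.congr (fun _ _ => rfl) (fun _ h => h) ?_
    intro z hz j hj hjz
    have hzy : z ≠ y := by rintro rfl; exact hyt.1 hz
    have hzx : z ≠ x := by rintro rfl; exact hxt (List.mem_cons_of_mem _ hz)
    have hza := h14 z (h6 z (List.mem_cons_of_mem _ hz)).1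
    have hjC : j ≠ C (back x) := by
      rintro rfl
      rw [hjz] at hRy
      exact hzy (hza.2.1.symm.trans hRy)
    simp [hjC, hzy, hzx, hjz]
  · simp
  · intro e he hek
    have := h9 e he hek
    clear h2 h3 h4 h5 h6 h7 h8 h9 h13
    simp only [Function.update_apply]; grind
  · intro hk
    exact absurd (h10 hk) (by simp)

theorem SearchInv.potential_advance (h : SearchInv n R C own asg cur vis back k x tail)
    (hl : IsRowList n R head nxt) (hc : cur x ≠ 0) :
    searchPotential n R (Function.update cur x (nxt (cur x))) k (x :: tail) <
      searchPotential n R cur k tail := by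
  have := hl.pending_advance (h.scan_spec hc).1 (h.scan_spec hc).2 rfl
  unfold searchPotential
  simp only [List.length_cons]
  omega

theorem searchPotential_init : searchPotential n R cur 1 [] ≤ 3 * n := by
  have := pending_le (n := n) (R := R) (cur := cur)
  unfold searchPotential
  simp only [List.length_nil]
  omega

/-- After a round without success, the visited columns and the rows that are not exhausted form a
vertex cover that is no larger than the matching. -/
theorem SearchInv.exists_cover (h : SearchInv n R C own asg cur vis back k x tail) (hk : n < k) :
    ∃ KR KC, IsCover n R C KR KC ∧ KR.card + KC.card ≤ matchingSize n C own := by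
  have ht := h.finished hk
  subst ht
  set J := ((edges n).image C).filter (fun j => own j ≠ 0) with hJ
  set KR := ((edges n).image R).filter (fun i => cur i ≠ 0) with hKR
  set KC := ((edges n).image C).filter (fun j => vis j ≠ 0) with hKC
  refine ⟨KR, KC, ?_, ?_⟩
  · intro e he
    have hs := h.scanned e he
    have := edges_pos he
    by_cases hc : cur (R e) = 0
    · exact Or.inr (Finset.mem_filter.2 ⟨Finset.mem_image_of_mem _ he, hs (by omega)⟩)
    · exact Or.inl (Finset.mem_filter.2 ⟨Finset.mem_image_of_mem _ he, hc⟩)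
  · have hasg : ∀ i ∈ KR, asg i ≠ 0 := by
      intro i hi ha
      obtain ⟨hi, hc⟩ := Finset.mem_filter.1 hi
      obtain ⟨e, he, rfl⟩ := Finset.mem_image.1 hi
      rcases h.done e he (by rw [mem_edges] at he; omega) ha with h' | h'
      · exact hc h'
      · omega
    have h1 : KR.card ≤ (J.filter (fun j => cur (R (own j)) ≠ 0)).card := by
      refine Finset.card_le_card_of_injOn (fun i => C (asg i)) ?_ ?_
      · intro i hi
        obtain ⟨ha1, ha2, ha3⟩ := h.matching.asg_spec i (hasg i hi)
        have hc := (Finset.mem_filter.1 hi).2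
        refine Finset.mem_coe.2 (Finset.mem_filter.2
          ⟨Finset.mem_filter.2 ⟨Finset.mem_image_of_mem _ ha1, ?_⟩, ?_⟩)
        · simp only
          rw [ha3]; exact hasg i hi
        · simp only
          rw [ha3, ha2]; exact hc
      · intro i hi i' hi' hii
        obtain ⟨-, ha2, ha3⟩ := h.matching.asg_spec _ (hasg i hi)
        obtain ⟨-, hb2, hb3⟩ := h.matching.asg_spec _ (hasg i' hi')
        simp only at hii
        rw [← ha2, ← hb2, ← ha3, ← hb3, hii]
    have h2 : KC.card ≤ (J.filter (fun j => ¬ cur (R (own j)) ≠ 0)).card := by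
      refine Finset.card_le_card fun j hj => ?_
      obtain ⟨hj, hv⟩ := Finset.mem_filter.1 hj
      obtain ⟨e, he, rfl⟩ := Finset.mem_image.1 hj
      obtain ⟨ho, hc⟩ := h.vis_own e he hv
      refine Finset.mem_filter.2 ⟨Finset.mem_filter.2 ⟨hj, ho⟩, ?_⟩
      simpa using hc
    have h3 := Finset.card_filter_add_card_filter_not (s := J) (fun j => cur (R (own j)) ≠ 0)
    have h4 : matchingSize n C own = J.card := rfl
    omega

end

/-! ### From matchings to edge covers -/

/-- `own` and `asg` come from the matching `own₀`, `asg₀` by choosing an arbitrary edge at some of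
the unmatched rows and columns. -/
structure IsExtension (n : ℕ) (R C own₀ asg₀ own asg : ℤ → ℤ) : Prop where
  own_spec : ∀ j, own j ≠ 0 → own j ∈ edges n ∧ C (own j) = j
  asg_spec : ∀ i, asg i ≠ 0 → asg i ∈ edges n ∧ R (asg i) = i
  own_eq : ∀ j, own₀ j ≠ 0 → own j = own₀ j
  asg_eq : ∀ i, asg₀ i ≠ 0 → asg i = asg₀ i

/-- Edge `e` is chosen at its column or at its row. -/
def IsChosen (R C own asg : ℤ → ℤ) (e : ℤ) : Prop := own (C e) = e ∨ asg (R e) = e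

section

variable {n : ℕ} {R C own₀ asg₀ own asg : ℤ → ℤ}

theorem IsMatching.isExtension (h : IsMatching n R C own asg) :
    IsExtension n R C own asg own asg :=
  ⟨fun j hj => ⟨(h.own_spec j hj).1, (h.own_spec j hj).2.1⟩,
    fun i hi => ⟨(h.asg_spec i hi).1, (h.asg_spec i hi).2.1⟩, fun _ _ => rfl, fun _ _ => rfl⟩

theorem IsExtension.update_own (h : IsExtension n R C own₀ asg₀ own asg) {e : ℤ}
    (he : e ∈ edges n) (ho : own (C e) = 0) :
    IsExtension n R C own₀ asg₀ (Function.update own (C e) e) asg := by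
  obtain ⟨h1, h2, h3, h4⟩ := h
  refine ⟨?_, h2, ?_, h4⟩ <;> intro j <;> simp only [Function.update_apply] <;> grind

theorem IsExtension.update_asg (h : IsExtension n R C own₀ asg₀ own asg) {e : ℤ}
    (he : e ∈ edges n) (ho : asg (R e) = 0) :
    IsExtension n R C own₀ asg₀ own (Function.update asg (R e) e) := by
  obtain ⟨h1, h2, h3, h4⟩ := h
  refine ⟨h1, ?_, h3, ?_⟩ <;> intro j <;> simp only [Function.update_apply] <;> grind

open Classical in
/-- The edges chosen at the rows and those chosen at the columns have the matching edges in
common. -/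
theorem IsExtension.card_chosen_add_le (h : IsExtension n R C own₀ asg₀ own asg)
    (h₀ : IsMatching n R C own₀ asg₀) :
    ((edges n).filter (IsChosen R C own asg)).card + matchingSize n C own₀ ≤
      ((edges n).image R).card + ((edges n).image C).card := by
  set A := ((edges n).image R).image asg
  set B := ((edges n).image C).image own
  set J := ((edges n).image C).filter (fun j => own₀ j ≠ 0) with hJ
  have h1 : A.card ≤ ((edges n).image R).card := Finset.card_image_le
  have h2 : B.card ≤ ((edges n).image C).card := Finset.card_image_le
  have h3 := Finset.card_union_add_card_inter A B
  have h4 : ((edges n).filter (IsChosen R C own asg)).card ≤ (A ∪ B).card := by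
    refine Finset.card_le_card fun e he => ?_
    obtain ⟨he, hc⟩ := Finset.mem_filter.1 he
    rcases hc with hc | hc
    · exact Finset.mem_union_right _
        (Finset.mem_image.2 ⟨C e, Finset.mem_image_of_mem _ he, hc⟩)
    · exact Finset.mem_union_left _
        (Finset.mem_image.2 ⟨R e, Finset.mem_image_of_mem _ he, hc⟩)
  have h5 : J.card ≤ (A ∩ B).card := by
    refine Finset.card_le_card_of_injOn own₀ ?_ ?_
    · intro j hj
      obtain ⟨hj, ho⟩ := Finset.mem_filter.1 hj
      obtain ⟨he, hC, ha⟩ := h₀.own_spec j ho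
      refine Finset.mem_coe.2 (Finset.mem_inter.2 ⟨Finset.mem_image.2 ⟨R (own₀ j),
        Finset.mem_image_of_mem _ he, ?_⟩, Finset.mem_image.2 ⟨j, hj, h.own_eq j ho⟩⟩)
      rw [h.asg_eq _ (by rw [ha]; exact ho), ha]
    · intro j hj j' hj' hjj
      rw [← (h₀.own_spec j (Finset.mem_filter.1 hj).2).2.1,
        ← (h₀.own_spec j' (Finset.mem_filter.1 hj').2).2.1, hjj]
  have h6 : matchingSize n C own₀ = J.card := rfl
  omega

/-- Every set of edges that reaches all rows and all columns has at least one edge for each vertex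
outside a vertex cover. -/
theorem IsCover.card_add_card_le {KR KC : Finset ℤ} (h : IsCover n R C KR KC) {F : Finset ℤ}
    (hF : F ⊆ edges n) (hR : (edges n).image R ⊆ F.image R) (hC : (edges n).image C ⊆ F.image C) :
    ((edges n).image R).card + ((edges n).image C).card ≤ F.card + (KR.card + KC.card) := by
  have h1 : ((edges n).image R \ KR).card ≤ (F.filter (fun e => R e ∉ KR)).card := by
    refine (Finset.card_le_card ?_).trans (Finset.card_image_le (f := R))
    intro i hi
    obtain ⟨hi, hK⟩ := Finset.mem_sdiff.1 hi
    obtain ⟨e, he, rfl⟩ := Finset.mem_image.1 (hR hi)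
    exact Finset.mem_image_of_mem _ (Finset.mem_filter.2 ⟨he, hK⟩)
  have h2 : ((edges n).image C \ KC).card ≤ (F.filter (fun e => ¬ R e ∉ KR)).card := by
    refine (Finset.card_le_card ?_).trans (Finset.card_image_le (f := C))
    intro i hi
    obtain ⟨hi, hK⟩ := Finset.mem_sdiff.1 hi
    obtain ⟨e, he, rfl⟩ := Finset.mem_image.1 (hC hi)
    exact Finset.mem_image_of_mem _ (Finset.mem_filter.2
      ⟨he, not_not.2 ((h e (hF he)).resolve_right hK)⟩)
  have h3 := Finset.card_filter_add_card_filter_not (s := F) (fun e => R e ∉ KR)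
  have h4 := Finset.le_card_sdiff KR ((edges n).image R)
  have h5 := Finset.le_card_sdiff KC ((edges n).image C)
  omega

end

/-! ### Total correctness with time bounds -/

/-- Started in the store `s`, the program `p` halts within `T` units of time in a store that
satisfies `Q`. -/
def Runs (p : Program) (s : Store) (T : ℕ) (Q : Store → Prop) : Prop :=
  ∃ s' t, Exec p s s' t ∧ t ≤ T ∧ Q s'

/-- The weakest precondition of a loop-free program; loops are rejected. -/
def wp : Program → (Store → Prop) → Store → Prop
  | .skip, Q, s => Q s
  | .set r e, Q, s => Q { reg := Function.update s.reg r (e.eval s), arr := s.arr }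
  | .put A i e, Q, s => Q
      { reg := s.reg
        arr := Function.update s.arr A (Function.update (s.arr A) (i.eval s) (e.eval s)) }
  | .seq p q, Q, s => wp p (wp q Q) s
  | .cond b p q, Q, s => (b.Holds s → wp p Q s) ∧ (¬ b.Holds s → wp q Q s)
  | .loop _ _, _, _ => False

/-- An upper bound for the running time of a loop-free program. -/
def maxTime : Program → ℕ
  | .skip => 1
  | .set _ e => e.cost + 1
  | .put _ i e => i.cost + e.cost + 1
  | .seq p q => maxTime p + maxTime q
  | .cond b p q => b.cost + 1 + (maxTime p + maxTime q)
  | .loop _ _ => 0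

theorem runs_of_wp {p : Program} {Q : Store → Prop} {s : Store} (h : wp p Q s) :
    Runs p s (maxTime p) Q := by
  induction p generalizing Q s with
  | skip => exact ⟨_, _, Exec.skip s, le_rfl, h⟩
  | set r e => exact ⟨_, _, Exec.set r e s, le_rfl, h⟩
  | put A i e => exact ⟨_, _, Exec.put A i e s, le_rfl, h⟩
  | seq p q ihp ihq =>
    obtain ⟨s₁, t₁, h₁, ht₁, hq⟩ := ihp h
    obtain ⟨s₂, t₂, h₂, ht₂, hQ⟩ := ihq hq
    exact ⟨s₂, _, Exec.seq h₁ h₂, Nat.add_le_add ht₁ ht₂, hQ⟩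
  | cond b p q ihp ihq =>
    by_cases hb : b.Holds s
    · obtain ⟨s₁, t₁, h₁, ht₁, hQ⟩ := ihp (h.1 hb)
      exact ⟨s₁, _, Exec.cond_true hb h₁, by simp only [maxTime]; omega, hQ⟩
    · obtain ⟨s₁, t₁, h₁, ht₁, hQ⟩ := ihq (h.2 hb)
      exact ⟨s₁, _, Exec.cond_false hb h₁, by simp only [maxTime]; omega, hQ⟩
  | loop b p => exact h.elim

theorem Runs.seq {p q : Program} {s : Store} {T₁ T₂ : ℕ} {Q₁ Q₂ : Store → Prop}
    (h₁ : Runs p s T₁ Q₁) (h₂ : ∀ s', Q₁ s' → Runs q s' T₂ Q₂) :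
    Runs (.seq p q) s (T₁ + T₂) Q₂ := by
  obtain ⟨s₁, t₁, e₁, ht₁, hq⟩ := h₁
  obtain ⟨s₂, t₂, e₂, ht₂, hQ⟩ := h₂ s₁ hq
  exact ⟨s₂, _, Exec.seq e₁ e₂, Nat.add_le_add ht₁ ht₂, hQ⟩

theorem Runs.mono {p : Program} {s : Store} {T T' : ℕ} {Q Q' : Store → Prop}
    (h : Runs p s T Q) (hT : T ≤ T') (hQ : ∀ s', Q s' → Q' s') : Runs p s T' Q' := by
  obtain ⟨s₁, t₁, e₁, ht₁, hq⟩ := h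
  exact ⟨s₁, t₁, e₁, ht₁.trans hT, hQ _ hq⟩

/-- The rule for loops: `I k` is an invariant with a potential `k`, which every iteration lowers;
every iteration takes at most `W` units of time. -/
theorem runs_loop {b : Test} {p : Program} {W : ℕ} (I : ℕ → Store → Prop)
    (hstep : ∀ k s, I k s → b.Holds s → Runs p s W (fun s' => ∃ k' < k, I k' s')) {k : ℕ} {s : Store}
    (hs : I k s) :
    Runs (.loop b p) s ((k + 1) * (b.cost + 1 + W)) (fun s' => ¬ b.Holds s' ∧ ∃ k', I k' s') := by
  induction k using Nat.strong_induction_on generalizing s with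
  | _ k ih =>
    by_cases hb : b.Holds s
    · obtain ⟨s₁, t₁, e₁, ht₁, k', hk', hI⟩ := hstep k s hs hb
      obtain ⟨s₂, t₂, e₂, ht₂, hQ⟩ := ih k' hk' hI
      refine ⟨s₂, _, Exec.loop_true hb e₁ e₂, ?_, hQ⟩
      have : (k' + 1) * (b.cost + 1 + W) ≤ k * (b.cost + 1 + W) := Nat.mul_le_mul_right _ hk'
      rw [Nat.add_mul, Nat.one_mul]
      omega
    · refine ⟨s, _, Exec.loop_false hb, ?_, hb, k, hs⟩
      nlinarith [Nat.zero_le (k * (b.cost + 1 + W))]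

/-! ### Iteration over the edges -/

/-- Sequential composition of a list of programs. -/
def block : List Program → Program
  | [] => .skip
  | p :: ps => .seq p (block ps)

/-- `forEdges body` runs `body` for the values `1, …, n` of the register `5`. -/
def forEdges (body : Program) : Program :=
  .seq (.set 5 (.const 1)) (.loop (.le (.reg 5) (.reg 0))
    (.seq body (.set 5 (.add (.reg 5) (.const 1)))))

/-- The constant in the time bound of `forEdges body`. -/
def forTime (body : Program) : ℕ := 4 + (maxTime body + 4)

theorem runs_forEdges {body : Program} {n : ℕ} {s : Store} (I : ℤ → Store → Prop)
    (hn : ∀ k s, I k s → s.reg 0 = n)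
    (h0 : I 1 { reg := Function.update s.reg 5 1, arr := s.arr })
    (hstep : ∀ k s, k ∈ edges n → s.reg 5 = k → I k s →
      wp (.seq body (.set 5 (.add (.reg 5) (.const 1))))
        (fun s' => s'.reg 5 = k + 1 ∧ I (k + 1) s') s) :
    Runs (forEdges body) s (2 + (n + 1) * forTime body) (I (n + 1)) := by
  have h1 : Runs (.set 5 (.const 1)) s 2 (fun s' => s'.reg 5 = 1 ∧ I 1 s') :=
    runs_of_wp (p := .set 5 (.const 1)) ⟨by simp [Expr.eval], by simpa [Expr.eval] using h0⟩
  refine h1.seq fun s₁ ⟨hk₁, hI₁⟩ => ?_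
  have h2 := runs_loop (b := .le (.reg 5) (.reg 0))
    (p := .seq body (.set 5 (.add (.reg 5) (.const 1)))) (W := maxTime body + 4)
    (fun m s => ∃ k : ℤ, 1 ≤ k ∧ k ≤ n + 1 ∧ m = (n + 1 - k).toNat ∧ s.reg 5 = k ∧ I k s)
    (fun m s ⟨k, hk1, hkn, hm, hk, hI⟩ hb => ?_) (k := n) (s := s₁)
    ⟨1, le_rfl, by omega, by omega, hk₁, hI₁⟩
  · refine h2.mono le_rfl fun s' ⟨hb, m, k, hk1, hkn, hm, hk, hI⟩ => ?_
    simp only [Test.Holds, Expr.eval, hk, hn k s' hI] at hb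
    have : k = n + 1 := by omega
    exact this ▸ hI
  · simp only [Test.Holds, Expr.eval, hk, hn k s hI] at hb
    refine (runs_of_wp (hstep k s (mem_edges.2 ⟨hk1, hb⟩) hk hI)).mono le_rfl ?_
    rintro s' ⟨hk', hI'⟩
    exact ⟨_, by omega, k + 1, by omega, by omega, rfl, hk', hI'⟩

/-! ### The program

Registers: `0` the number `n` of edges, `5` a loop counter `k`, `6` the bound `L`, `7` its square,
`8` the active row `x`, `9` an edge `e`, `10` a column `j`, `11` an edge `f`, `12` a flag.
Arrays: `0` rows and `1` columns of the edges (edge `e` at the index `e - 1`), `2` the output,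
`3` and `4` the lists `head` and `nxt`, `5` the scan pointers `cur`, `6` the levels `d`, `7` the
prices `p`, `8` and `9` the matching `own` and `asg`, `10` the marks `vis`, `11` the former edges
`back`. -/

/-- The row of an edge. -/
def rowOf (e : Expr) : Expr := .get 0 (.sub e (.const 1))

/-- The column of an edge. -/
def colOf (e : Expr) : Expr := .get 1 (.sub e (.const 1))

/-- Increments `L` and updates its square. -/
def rootBody : Program := block [
  .set 7 (.add (.reg 7) (.add (.add (.reg 6) (.reg 6)) (.const 1))),
  .set 6 (.add (.reg 6) (.const 1))]

/-- Computes the least `L` with `n ≤ L * L`. -/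
def rootProgram : Program := .loop (.neg (.le (.reg 0) (.reg 7))) rootBody

/-- Builds the lists of the edges of each row, and lets the scan pointers start at the heads. -/
def listBody : Program := block [
  .put 4 (.reg 5) (.get 3 (rowOf (.reg 5))),
  .put 3 (rowOf (.reg 5)) (.reg 5),
  .put 5 (rowOf (.reg 5)) (.reg 5)]

/-- A step of the auction: proceed to the next row if `x` is settled; raise the level of `x` if its
scan is complete; otherwise look at the next edge of `x`. -/
def auctionBody : Program :=
  .cond (.and (.eq (.get 9 (.reg 8)) (.const 0)) (.neg (.le (.reg 6) (.get 6 (.reg 8)))))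
    (.cond (.eq (.get 5 (.reg 8)) (.const 0))
      (block [
        .put 6 (.reg 8) (.add (.get 6 (.reg 8)) (.const 1)),
        .put 5 (.reg 8) (.get 3 (.reg 8))])
      (block [
        .set 9 (.get 5 (.reg 8)),
        .set 10 (colOf (.reg 9)),
        .put 5 (.reg 8) (.get 4 (.reg 9)),
        .cond (.eq (.get 7 (.reg 10)) (.get 6 (.reg 8)))
          (block [
            .put 7 (.reg 10) (.add (.get 7 (.reg 10)) (.const 1)),
            .put 9 (.reg 8) (.reg 9),
            .set 11 (.get 8 (.reg 10)),
            .put 8 (.reg 10) (.reg 9),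
            .cond (.eq (.reg 11) (.const 0)) .skip
              (block [.set 8 (rowOf (.reg 11)), .put 9 (.reg 8) (.const 0)])])
          .skip]))
    (block [.set 5 (.add (.reg 5) (.const 1)), .set 8 (rowOf (.reg 5))])

/-- Starts a loop over the edges with their rows in the register `8`. -/
def startProgram : Program := block [.set 5 (.const 1), .set 8 (rowOf (.reg 5))]

/-- Runs the auction from the row of the edge `1`. -/
def auctionProgram : Program :=
  .seq startProgram (.loop (.le (.reg 5) (.reg 0)) auctionBody)

/-- Resets the scan pointers and the marks. -/
def resetBody : Program := block [
  .put 5 (rowOf (.reg 5)) (.get 3 (rowOf (.reg 5))),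
  .put 10 (colOf (.reg 5)) (.const 0)]

/-- A step of the search: proceed to the next root if `x` is matched or an exhausted root; let an
exhausted row take its former column back; otherwise look at the next edge of `x`. -/
def searchBody : Program :=
  .cond (.and (.eq (.get 9 (.reg 8)) (.const 0))
      (.neg (.and (.eq (.get 5 (.reg 8)) (.const 0)) (.eq (.reg 8) (rowOf (.reg 5))))))
    (.cond (.eq (.get 5 (.reg 8)) (.const 0))
      (block [
        .set 9 (.get 11 (.reg 8)),
        .set 10 (colOf (.reg 9)),
        .put 9 (.reg 8) (.reg 9),
        .set 11 (.get 8 (.reg 10)),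
        .put 8 (.reg 10) (.reg 9),
        .set 8 (rowOf (.reg 11)),
        .put 9 (.reg 8) (.const 0)])
      (block [
        .set 9 (.get 5 (.reg 8)),
        .set 10 (colOf (.reg 9)),
        .put 5 (.reg 8) (.get 4 (.reg 9)),
        .cond (.eq (.get 10 (.reg 10)) (.const 0))
          (block [
            .put 10 (.reg 10) (.const 1),
            .put 9 (.reg 8) (.reg 9),
            .set 11 (.get 8 (.reg 10)),
            .put 8 (.reg 10) (.reg 9),
            .cond (.eq (.reg 11) (.const 0))
              (block [.set 12 (.const 1), .set 5 (.add (.reg 0) (.const 1))])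
              (block [
                .set 8 (rowOf (.reg 11)),
                .put 9 (.reg 8) (.const 0),
                .put 11 (.reg 8) (.reg 11)])])
          .skip]))
    (block [.set 5 (.add (.reg 5) (.const 1)), .set 8 (rowOf (.reg 5))])

/-- A round of the search; the flag tells whether it has enlarged the matching. -/
def roundProgram : Program :=
  .seq (.set 12 (.const 0)) (.seq (forEdges resetBody)
    (.seq startProgram (.loop (.le (.reg 5) (.reg 0)) searchBody)))

/-- Repeats the rounds of the search until one of them fails. -/
def matchingProgram : Program :=
  .seq (.set 12 (.const 1)) (.loop (.eq (.reg 12) (.const 1)) roundProgram)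

/-- Chooses an edge at every unmatched row and column. -/
def extendBody : Program := block [
  .cond (.eq (.get 9 (rowOf (.reg 5))) (.const 0)) (.put 9 (rowOf (.reg 5)) (.reg 5)) .skip,
  .cond (.eq (.get 8 (colOf (.reg 5))) (.const 0)) (.put 8 (colOf (.reg 5)) (.reg 5)) .skip]

/-- Writes `0` for the chosen edges and `1` for the others. -/
def outputBody : Program :=
  .cond (.and (.neg (.eq (.get 8 (colOf (.reg 5))) (.reg 5)))
      (.neg (.eq (.get 9 (rowOf (.reg 5))) (.reg 5))))
    (.put 2 (.sub (.reg 5) (.const 1)) (.const 1))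
    (.put 2 (.sub (.reg 5) (.const 1)) (.const 0))

/-- The program that finds a maximum free set. -/
def freeSetProgram : Program :=
  .seq rootProgram (.seq (forEdges listBody) (.seq auctionProgram
    (.seq matchingProgram (.seq (forEdges extendBody) (forEdges outputBody)))))

/-- The store holds the number, the rows and the columns of the edges. -/
structure HasInput (n : ℕ) (R C : ℤ → ℤ) (s : Store) : Prop where
  reg_zero : s.reg 0 = n
  arr_zero : s.arr 0 = fun z => R (z + 1)
  arr_one : s.arr 1 = fun z => C (z + 1)

section

variable {n L : ℕ} {R C : ℤ → ℤ} {s : Store}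

/-! ### The bound `L` and the row lists -/

theorem runs_rootProgram (h : HasInput n R C s) (h6 : s.reg 6 = 0) (h7 : s.reg 7 = 0) :
    Runs rootProgram s ((n + 1) * (5 + maxTime rootBody))
      (fun s' => HasInput n R C s' ∧ s'.arr = s.arr ∧
        ∃ L : ℕ, s'.reg 6 = L ∧ n ≤ L * L ∧ (L = 0 ∨ (L - 1) * (L - 1) < n)) := by
  refine (runs_loop (fun k s' => HasInput n R C s' ∧ s'.arr = s.arr ∧ ∃ l : ℕ, s'.reg 6 = l ∧
    s'.reg 7 = l * l ∧ (l = 0 ∨ (l - 1) * (l - 1) < n) ∧ k = n - l * l) ?_ (k := n)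
    ⟨h, rfl, 0, by simp [h6], by simp [h7], by simp, by simp⟩).mono le_rfl ?_
  · rintro k s' ⟨⟨h0, h1, h2⟩, ha, l, hl6, hl7, hl, rfl⟩ hb
    refine runs_of_wp ?_
    simp only [Test.Holds, Expr.eval, h0, hl7, not_le] at hb
    have hb' : l * l < n := by exact_mod_cast hb
    simp only [wp, rootBody, block, Expr.eval, Function.update_apply]
    have : (l + 1) * (l + 1) = l * l + 2 * l + 1 := by ring
    refine ⟨n - (l + 1) * (l + 1), by omega, ⟨by simpa using h0, h1, h2⟩, ha, l + 1, ?_, ?_, ?_, rfl⟩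
    · simp [hl6]
    · simp [hl6, hl7]; ring
    · right; simpa using hb'
  · rintro s' ⟨hb, k, ⟨h0, h1, h2⟩, ha, l, hl6, hl7, hl, -⟩
    simp only [Test.Holds, Expr.eval, h0, hl7, not_not] at hb
    exact ⟨⟨h0, h1, h2⟩, ha, l, hl6, by exact_mod_cast hb, hl⟩

/-- Adding the edge `e = m + 1` at the head of the list of its row. -/
theorem IsRowList.cons {m : ℕ} {head nxt : ℤ → ℤ} (h : IsRowList m R head nxt) {e : ℤ}
    (he : e = m + 1) : IsRowList (m + 1) R (Function.update head (R e) e)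
      (Function.update nxt e (head (R e))) := by
  have hmem : ∀ e', e' ∈ edges (m + 1) ↔ e' ∈ edges m ∨ e' = e := by
    intro e'
    simp only [mem_edges]
    push_cast
    omega
  have hlt : ∀ e' ∈ edges m, 0 < e' ∧ e' < e := fun e' he' => by
    rw [mem_edges] at he'; omega
  have he0 : 0 < e := by omega
  obtain ⟨h1, h2, h3, h4, h5⟩ := h
  have h1e := h1 (R e)
  refine ⟨?_, ?_, ?_, ?_, ?_⟩
  · intro i
    have := h1 i
    simp only [Function.update_apply, hmem]; grind
  · intro e' he'
    have := h2 e'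
    have := hlt e'
    simp only [Function.update_apply, hmem] at *; grind
  · intro e' he'
    have := h3 e'
    simp only [Function.update_apply, hmem] at *; grind
  · intro e' he'
    have := h4 e'
    have := hlt (head (R e))
    simp only [Function.update_apply, hmem] at *; grind
  · intro e' he' e'' he'' hR hlt'
    have := h5 e'
    have := h2 e''
    have := hlt e'
    have := hlt e''
    simp only [Function.update_apply, hmem] at *; grind

theorem runs_lists (h : HasInput n R C s) (h3 : s.arr 3 = fun _ => 0) (h5 : s.arr 5 = fun _ => 0) :
    Runs (forEdges listBody) s (2 + (n + 1) * forTime listBody)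
      (fun s' => HasInput n R C s' ∧ IsRowList n R (s'.arr 3) (s'.arr 4) ∧ s'.arr 5 = s'.arr 3 ∧
        s'.reg 6 = s.reg 6 ∧ ∀ A, 5 < A → s'.arr A = s.arr A) := by
  refine (runs_forEdges (fun k s' => HasInput n R C s' ∧
    IsRowList (k - 1).toNat R (s'.arr 3) (s'.arr 4) ∧ s'.arr 5 = s'.arr 3 ∧
        s'.reg 6 = s.reg 6 ∧ ∀ A, 5 < A → s'.arr A = s.arr A) (fun k s h => h.1.reg_zero) ?_ ?_).mono
    le_rfl ?_
  · refine ⟨⟨by simpa using h.1, h.2, h.3⟩, ?_, by simp [h3, h5], by simp, by simp⟩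
    have hE : edges 0 = ∅ := by simp [edges]
    constructor <;> simp [h3, hE]
  · rintro k s' hk h5 ⟨⟨h0, h1, h2⟩, hl, hc, h6, hA⟩
    rw [mem_edges] at hk
    simp only [wp, listBody, block, Expr.eval, rowOf, Function.update_apply, ↓reduceIte,
      Nat.reduceEqDiff, h5, h1, sub_add_cancel]
    refine ⟨trivial, ⟨by simpa using h0, by simpa using h1, by simpa using h2⟩, ?_, ?_,
      by simpa using h6, ?_⟩
    · have h := hl.cons (e := k) (by omega)
      have hk' : (k - 1).toNat + 1 = (k + 1 - 1).toNat := by omega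
      rw [hk'] at h
      simpa using h
    · simp [hc]
    · intro A hA'
      have h3 : A ≠ 3 := by omega
      have h4 : A ≠ 4 := by omega
      have h5 : A ≠ 5 := by omega
      simp [h3, h4, h5, hA A hA']
  · rintro s' ⟨h, hl, h'⟩
    exact ⟨h, by simpa using hl, h'⟩

/-! ### The run of the auction -/

/-- The store during the auction. -/
structure AuctionState (n : ℕ) (R C : ℤ → ℤ) (L : ℕ) (s : Store) : Prop where
  input : HasInput n R C s
  lists : IsRowList n R (s.arr 3) (s.arr 4)
  bound : s.reg 6 = L
  one_le : 1 ≤ s.reg 5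
  inv : AuctionInv n R C (s.arr 8) (s.arr 9) (s.arr 5) (s.arr 6) (s.arr 7) L (s.reg 5) (s.reg 8)

theorem wp_auctionBody (h : AuctionState n R C L s) (hk : s.reg 5 ≤ n) :
    wp auctionBody (fun s' => AuctionState n R C L s' ∧
      auctionPotential n R (s'.arr 5) (s'.arr 6) L (s'.reg 5) <
        auctionPotential n R (s.arr 5) (s.arr 6) L (s.reg 5)) s := by
  obtain ⟨⟨h0, h1, h2⟩, hl, h6, hk1, hi⟩ := h
  simp only [wp, auctionBody, block, Test.Holds, Expr.eval, rowOf, colOf, Function.update_apply,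
    ↓reduceIte, Nat.reduceEqDiff, h1, h2, h6, sub_add_cancel, add_sub_cancel_right, not_le]
  -- The five paths through the body: `x` raises its level, takes an unmatched column, displaces a
  -- row, skips an expensive column, or is settled.
  refine ⟨fun ⟨ha, hd⟩ => ⟨fun hc => ?_, fun hc => ⟨fun hp => ⟨fun ho => ?_, fun ho => ?_⟩,
    fun hp => ?_⟩⟩, fun hx => ?_⟩
  · exact ⟨⟨⟨by simpa using h0, by simpa using h1, by simpa using h2⟩, by simpa using hl,
      by simpa using h6, by simpa using hk1, hi.raise hl ha hc⟩, hi.potential_raise hk hd⟩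
  · exact ⟨⟨⟨by simpa using h0, by simpa using h1, by simpa using h2⟩, by simpa using hl,
      by simpa using h6, by simpa using hk1, hi.take hl ha hc hp ho⟩, hi.potential_advance hl hc⟩
  · exact ⟨⟨⟨by simpa using h0, by simpa using h1, by simpa using h2⟩, by simpa using hl,
      by simpa using h6, by simpa using hk1, hi.displace hl hk ha hc hp ho⟩,
      hi.potential_advance hl hc⟩
  · exact ⟨⟨⟨by simpa using h0, by simpa using h1, by simpa using h2⟩, by simpa using hl,
      by simpa using h6, by simpa using hk1, hi.skip hl hc hp⟩, hi.potential_advance hl hc⟩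
  · refine ⟨⟨⟨by simpa using h0, by simpa using h1, by simpa using h2⟩, by simpa using hl,
      by simpa using h6, by simp; omega, ?_⟩, auctionPotential_next hk⟩
    have := hi.next hx ⟨hk1, hk⟩
    simpa using this

theorem runs_auctionProgram (hn : 0 < n) (hL : n ≤ L * L) (h : HasInput n R C s)
    (hl : IsRowList n R (s.arr 3) (s.arr 4)) (hc : s.arr 5 = s.arr 3) (h6 : s.reg 6 = L)
    (hA : ∀ A, 5 < A → s.arr A = fun _ => 0) :
    Runs auctionProgram s (maxTime startProgram +
      (n * (2 * L + 2) + 1) * (4 + maxTime auctionBody))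
      (fun s' => HasInput n R C s' ∧ IsRowList n R (s'.arr 3) (s'.arr 4) ∧
        IsRowPointer n R (s'.arr 5) ∧ IsMatching n R C (s'.arr 8) (s'.arr 9) ∧
        ∀ own asg, IsMatching n R C own asg →
          matchingSize n C own ≤ matchingSize n C (s'.arr 8) + L) := by
  obtain ⟨h0, h1, h2⟩ := h
  refine Runs.seq (Q₁ := fun s' => AuctionState n R C L s' ∧
    auctionPotential n R (s'.arr 5) (s'.arr 6) L (s'.reg 5) ≤ n * (2 * L + 2))
    (runs_of_wp ?_) fun s₁ hs₁ => ?_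
  · simp only [wp, startProgram, block, Expr.eval, rowOf, Function.update_apply,
      ↓reduceIte, Nat.reduceEqDiff, h1, sub_add_cancel]
    refine ⟨⟨⟨by simpa using h0, by simpa using h1, by simpa using h2⟩, by simpa using hl,
      by simpa using h6, by simp, ?_⟩, ?_⟩
    · have := AuctionInv.init (L := L) (C := C) hl hn
      simpa [hc, hA] using this
    · rw [hA 6 (by norm_num)]
      exact auctionPotential_init L
  · refine (runs_loop (fun k s' => AuctionState n R C L s' ∧
      auctionPotential n R (s'.arr 5) (s'.arr 6) L (s'.reg 5) ≤ k) ?_ hs₁).mono le_rfl ?_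
    · rintro k s' ⟨hs, hp⟩ hb
      simp only [Test.Holds, Expr.eval, hs.input.reg_zero] at hb
      refine (runs_of_wp (wp_auctionBody hs hb)).mono le_rfl ?_
      rintro s'' ⟨hs', hp'⟩
      exact ⟨_, hp'.trans_le hp, hs', le_rfl⟩
    · rintro s' ⟨hb, k, hs, -⟩
      simp only [Test.Holds, Expr.eval, hs.input.reg_zero, not_le] at hb
      exact ⟨hs.input, hs.lists, hs.inv.cur_spec, hs.inv.matching,
        fun own asg hm => hs.inv.matchingSize_le_add hb hL hn hm⟩

/-! ### The run of the search -/

/-- The store during a round that started with a matching of size `m`; `pot` bounds the number of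
remaining steps.  The flag and the counter are set on success. -/
structure SearchState (n : ℕ) (R C : ℤ → ℤ) (m pot : ℕ) (s : Store) : Prop where
  input : HasInput n R C s
  lists : IsRowList n R (s.arr 3) (s.arr 4)
  inv : (s.reg 12 = 0 ∧ matchingSize n C (s.arr 8) = m ∧
      ∃ tail, SearchInv n R C (s.arr 8) (s.arr 9) (s.arr 5) (s.arr 10) (s.arr 11)
        (s.reg 5) (s.reg 8) tail ∧ searchPotential n R (s.arr 5) (s.reg 5) tail ≤ pot) ∨
    (s.reg 12 = 1 ∧ s.reg 5 = n + 1 ∧ IsRowPointer n R (s.arr 5) ∧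
      IsMatching n R C (s.arr 8) (s.arr 9) ∧
      matchingSize n C (s.arr 8) = m + 1)

theorem wp_searchBody {m pot : ℕ} (h : SearchState n R C m pot s) (hk : s.reg 5 ≤ n) :
    wp searchBody (fun s' => ∃ pot' < pot, SearchState n R C m pot' s') s := by
  obtain ⟨⟨h0, h1, h2⟩, hl, ⟨hf, hm, tail, hi, hpot⟩ | ⟨-, h5, -⟩⟩ := h
  swap
  · omega
  simp only [wp, searchBody, block, Test.Holds, Expr.eval, rowOf, colOf, Function.update_apply,
    ↓reduceIte, Nat.reduceEqDiff, h1, h2, sub_add_cancel, add_sub_cancel_right]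
  -- The five paths through the body: `x` takes its column back, reaches an unmatched column,
  -- displaces a row, skips a visited column, or is done with.
  refine ⟨fun ⟨ha, hx⟩ => ⟨fun hc => ?_, fun hc => ⟨fun hv => ⟨fun ho => ?_, fun ho => ?_⟩,
    fun hv => ?_⟩⟩, fun hx => ?_⟩
  · obtain ⟨hb, ho, t, rfl, hi'⟩ := hi.pop ha hc fun hx' => hx ⟨hc, hx'⟩
    have hp : searchPotential n R (s.arr 5) (s.reg 5) t < pot := by
      refine lt_of_lt_of_le ?_ hpot
      simp [searchPotential]
    refine ⟨_, hp, ⟨by simpa using h0, by simpa using h1, by simpa using h2⟩, by simpa using hl,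
      Or.inl ⟨by simpa using hf, ?_, t, hi', le_rfl⟩⟩
    exact (matchingSize_displace (edges_pos hb).ne' ho).trans hm
  · have hp := hi.potential_advance hl hc
    have hs := hi.scan_spec hc
    refine ⟨0, by omega, ⟨by simpa using h0, by simpa using h1, by simpa using h2⟩,
      by simpa using hl, Or.inr ⟨by simp, by simp [h0],
        IsRowPointer.advance hi.cur_spec hl hc, hi.matching.take hs.1 hs.2 ha ho, ?_⟩⟩
    have := matchingSize_take hs.1 ho
    simp only [Function.update_apply, ↓reduceIte]
    omega
  · have hp := hi.potential_advance hl hc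
    have hs := hi.scan_spec hc
    refine ⟨_, lt_of_lt_of_le hp hpot, ⟨by simpa using h0, by simpa using h1, by simpa using h2⟩,
      by simpa using hl, Or.inl ⟨by simpa using hf, ?_, _, hi.push hl hk ha hc hv ho, le_rfl⟩⟩
    exact (matchingSize_displace hc ho).trans hm
  · have hp := hi.potential_advance hl hc
    refine ⟨_, lt_of_lt_of_le (lt_of_le_of_lt ?_ hp) hpot,
      ⟨by simpa using h0, by simpa using h1, by simpa using h2⟩,
      by simpa using hl, Or.inl ⟨by simpa using hf, by simpa using hm, _,
        hi.skip hl hk hc hv, le_rfl⟩⟩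
    simp [searchPotential]
  · have hx' : s.arr 9 (s.reg 8) ≠ 0 ∨ (s.arr 5 (s.reg 8) = 0 ∧ s.reg 8 = R (s.reg 5)) := by tauto
    have hi' := hi.next hx'
    have hp : searchPotential n R (s.arr 5) (s.reg 5 + 1) [] < pot := by
      refine lt_of_lt_of_le ?_ hpot
      simp only [searchPotential, List.length_nil]
      omega
    refine ⟨_, hp, ⟨by simpa using h0, by simpa using h1, by simpa using h2⟩,
      by simpa using hl, Or.inl ⟨by simpa using hf, by simpa using hm, _, ?_, le_rfl⟩⟩
    simpa using hi'

/-- The time bound of a round. -/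
def roundTime (n : ℕ) : ℕ :=
  2 + ((2 + (n + 1) * forTime resetBody) + (maxTime startProgram +
    (3 * n + 1) * (4 + maxTime searchBody)))

theorem runs_roundProgram (hn : 0 < n) (h : HasInput n R C s)
    (hl : IsRowList n R (s.arr 3) (s.arr 4)) (hcur : IsRowPointer n R (s.arr 5))
    (hm : IsMatching n R C (s.arr 8) (s.arr 9)) :
    Runs roundProgram s (roundTime n) (fun s' => HasInput n R C s' ∧
      IsRowList n R (s'.arr 3) (s'.arr 4) ∧ IsRowPointer n R (s'.arr 5) ∧
      IsMatching n R C (s'.arr 8) (s'.arr 9) ∧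
      ((s'.reg 12 = 0 ∧ ∃ KR KC, IsCover n R C KR KC ∧
          KR.card + KC.card ≤ matchingSize n C (s'.arr 8)) ∨
        (s'.reg 12 = 1 ∧ matchingSize n C (s'.arr 8) = matchingSize n C (s.arr 8) + 1))) := by
  obtain ⟨h0, h1, h2⟩ := h
  refine Runs.seq (Q₁ := fun s' => s'.arr = s.arr ∧ s'.reg 0 = n ∧ s'.reg 12 = 0)
    (runs_of_wp (p := .set 12 (.const 0)) ⟨rfl, by simpa using h0, by simp [Expr.eval]⟩)
    fun s₁ ⟨ha₁, hn₁, hf₁⟩ => ?_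
  refine Runs.seq (runs_forEdges (fun k s' => HasInput n R C s' ∧ s'.reg 12 = 0 ∧
    s'.arr 3 = s.arr 3 ∧ s'.arr 4 = s.arr 4 ∧ s'.arr 8 = s.arr 8 ∧ s'.arr 9 = s.arr 9 ∧
    IsRowPointer n R (s'.arr 5) ∧
    (∀ e ∈ edges n, e < k → s'.arr 5 (R e) = s.arr 3 (R e)) ∧
    (∀ e ∈ edges n, e < k → s'.arr 10 (C e) = 0)) (fun k s h => h.1.reg_zero) ?_ ?_)
    fun s₂ ⟨⟨h0', h1', h2'⟩, hf₂, h3, h4, h8, h9, hc, hh, hv⟩ => ?_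
  · exact ⟨⟨by simpa using hn₁, ha₁ ▸ h1, ha₁ ▸ h2⟩, by simpa using hf₁, by simp [ha₁],
      by simp [ha₁], by simp [ha₁], by simp [ha₁],
      by simpa [ha₁] using hcur, fun e he h1 => by
        have := edges_pos he; omega, fun e he h1 => by have := edges_pos he; omega⟩
  · rintro k s' hk h5 ⟨⟨h0, h1, h2⟩, hf, h3, h4, h8, h9, hc, hh, hv⟩
    simp only [wp, resetBody, block, Expr.eval, rowOf, colOf, Function.update_apply, ↓reduceIte,
      Nat.reduceEqDiff, h5, h1, h2, h3, sub_add_cancel]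
    refine ⟨trivial, ⟨by simpa using h0, by simpa using h1, by simpa using h2⟩, by simpa using hf,
      by simp, by simpa using h4, by simpa using h8, by simpa using h9, ?_, ?_, ?_⟩
    · intro i
      have := hc i
      have := hl.head_spec i
      simp only [Function.update_apply]; grind
    · intro e he hek
      have := hh e he
      split_ifs with hr
      · rw [hr]
      · exact this (lt_of_le_of_ne (by omega) fun h => hr (by rw [h]))
    · intro e he hek
      have := hv e he
      split_ifs with hr
      · rfl
      · exact this (lt_of_le_of_ne (by omega) fun h => hr (by rw [h]))
  refine Runs.seq (Q₁ := fun s' => SearchState n R C (matchingSize n C (s.arr 8)) (3 * n) s')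
    (runs_of_wp ?_) fun s₃ hs₃ => ?_
  · simp only [wp, startProgram, block, Expr.eval, rowOf, Function.update_apply,
      ↓reduceIte, h1', sub_add_cancel]
    refine ⟨⟨by simpa using h0', by simpa using h1', by simpa using h2'⟩, by simpa [h3, h4] using hl,
      Or.inl ⟨by simpa using hf₂, by simp [h8], [], ?_, ?_⟩⟩
    · have hm' : IsMatching n R C (s₂.arr 8) (s₂.arr 9) := by rw [h8, h9]; exact hm
      have hlt : ∀ e ∈ edges n, e < n + 1 := fun e he => by rw [mem_edges] at he; omega
      have := SearchInv.init (back := s₂.arr 11) hm' hl hc (fun e he => hh e he (hlt e he))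
        (fun e he => hv e he (hlt e he)) hn
      simpa using this
    · exact searchPotential_init
  · refine (runs_loop (fun pot s' => SearchState n R C (matchingSize n C (s.arr 8)) pot s') ?_
      hs₃).mono le_rfl ?_
    · intro pot s' hs hb
      simp only [Test.Holds, Expr.eval, hs.input.reg_zero] at hb
      exact runs_of_wp (wp_searchBody hs hb)
    · rintro s' ⟨hb, pot, hs⟩
      simp only [Test.Holds, Expr.eval, hs.input.reg_zero, not_le] at hb
      obtain ⟨hin, hls, ⟨hf, hsz, tail, hi, -⟩ | ⟨hf, -, hcur', hm', hsz⟩⟩ := hs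
      · exact ⟨hin, hls, hi.cur_spec, hi.matching, Or.inl ⟨hf, hi.exists_cover hb⟩⟩
      · exact ⟨hin, hls, hcur', hm', Or.inr ⟨hf, hsz⟩⟩

/-- Every round but the last enlarges the matching, and the matching after the auction can be
enlarged at most `L` times, so that there are at most `L + 1` rounds. -/
theorem runs_matchingProgram (hn : 0 < n) (h : HasInput n R C s)
    (hl : IsRowList n R (s.arr 3) (s.arr 4)) (hcur : IsRowPointer n R (s.arr 5))
    (hm : IsMatching n R C (s.arr 8) (s.arr 9))
    (hmax : ∀ own asg, IsMatching n R C own asg →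
      matchingSize n C own ≤ matchingSize n C (s.arr 8) + L) :
    Runs matchingProgram s (2 + (L + 1 + 1) * (4 + roundTime n)) (fun s' =>
      HasInput n R C s' ∧ IsMatching n R C (s'.arr 8) (s'.arr 9) ∧
      ∃ KR KC, IsCover n R C KR KC ∧ KR.card + KC.card ≤ matchingSize n C (s'.arr 8)) := by
  set B := matchingSize n C (s.arr 8) + L
  obtain ⟨h0, h1, h2⟩ := h
  refine Runs.seq (Q₁ := fun s' => s'.arr = s.arr ∧ s'.reg 0 = n ∧ s'.reg 12 = 1)
    (runs_of_wp (p := .set 12 (.const 1)) ⟨rfl, by simpa using h0, by simp [Expr.eval]⟩)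
    fun s₁ ⟨ha₁, hn₁, hf₁⟩ => ?_
  refine (runs_loop (fun k s' => HasInput n R C s' ∧
      IsRowList n R (s'.arr 3) (s'.arr 4) ∧ IsRowPointer n R (s'.arr 5) ∧
      IsMatching n R C (s'.arr 8) (s'.arr 9) ∧
      ((s'.reg 12 = 0 ∧ ∃ KR KC, IsCover n R C KR KC ∧
          KR.card + KC.card ≤ matchingSize n C (s'.arr 8)) ∨
        (s'.reg 12 = 1 ∧ B + 1 - matchingSize n C (s'.arr 8) = k))) ?_ (k := L + 1) ?_).mono
    le_rfl ?_
  · rintro k s' ⟨hin, hls, hcs, hms, hor⟩ hb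
    simp only [Test.Holds, Expr.eval] at hb
    rcases hor with ⟨hf, -⟩ | ⟨-, hk⟩
    · omega
    have hB := hmax _ _ hms
    refine (runs_roundProgram hn hin hls hcs hms).mono le_rfl ?_
    rintro s'' ⟨hin', hls', hcs', hms', ⟨hf', hcov⟩ | ⟨hf', hsz⟩⟩
    · exact ⟨0, by omega, hin', hls', hcs', hms', Or.inl ⟨hf', hcov⟩⟩
    · have hB' := hmax _ _ hms'
      exact ⟨_, by omega, hin', hls', hcs', hms', Or.inr ⟨hf', rfl⟩⟩
  · rw [ha₁]
    exact ⟨⟨hn₁, ha₁ ▸ h1, ha₁ ▸ h2⟩, hl, hcur, hm, Or.inr ⟨hf₁, by omega⟩⟩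
  · rintro s' ⟨hb, k, hin, hls, -, hms, ⟨hf, hcov⟩ | ⟨hf, -⟩⟩
    · exact ⟨hin, hms, hcov⟩
    · exact absurd hf hb

/-! ### The run of the output phase -/

theorem runs_extend (h : HasInput n R C s) (hm : IsMatching n R C (s.arr 8) (s.arr 9)) :
    Runs (forEdges extendBody) s (2 + (n + 1) * forTime extendBody) (fun s' =>
      HasInput n R C s' ∧ IsExtension n R C (s.arr 8) (s.arr 9) (s'.arr 8) (s'.arr 9) ∧
      ∀ e ∈ edges n, s'.arr 8 (C e) ≠ 0 ∧ s'.arr 9 (R e) ≠ 0) := by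
  refine (runs_forEdges (fun k s' => HasInput n R C s' ∧
      IsExtension n R C (s.arr 8) (s.arr 9) (s'.arr 8) (s'.arr 9) ∧
      ∀ e ∈ edges n, e < k → s'.arr 8 (C e) ≠ 0 ∧ s'.arr 9 (R e) ≠ 0)
    (fun k s h => h.1.reg_zero) ?_ ?_).mono le_rfl ?_
  · exact ⟨⟨by simpa using h.1, h.2, h.3⟩, hm.isExtension, fun e he h1 => by
      have := edges_pos he; omega⟩
  · rintro k s' hk h5 ⟨⟨h0, h1, h2⟩, hx, hd⟩
    have hk0 := edges_pos hk
    simp only [wp, extendBody, block, Test.Holds, Expr.eval, rowOf, colOf, Function.update_apply,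
      ↓reduceIte, Nat.reduceEqDiff, h5, h1, h2, sub_add_cancel]
    have key : ∀ own asg : ℤ → ℤ, (∀ j, s'.arr 8 j ≠ 0 → own j ≠ 0) →
        (∀ i, s'.arr 9 i ≠ 0 → asg i ≠ 0) → own (C k) ≠ 0 → asg (R k) ≠ 0 →
        ∀ e ∈ edges n, e < k + 1 → own (C e) ≠ 0 ∧ asg (R e) ≠ 0 := by
      intro own asg h8 h9 hC hR e he hek
      rcases lt_or_eq_of_le (Int.lt_add_one_iff.1 hek) with hlt | rfl
      · exact ⟨h8 _ (hd e he hlt).1, h9 _ (hd e he hlt).2⟩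
      · exact ⟨hC, hR⟩
    have hupd : ∀ (g : ℤ → ℤ) (i j : ℤ), g j ≠ 0 → Function.update g i k j ≠ 0 := by
      intro g i j hj
      rw [Function.update_apply]
      split_ifs <;> omega
    have hin : ∀ (r : ℤ) (a : ℕ → ℤ → ℤ), a 0 = s'.arr 0 → a 1 = s'.arr 1 →
        HasInput n R C { reg := Function.update s'.reg 5 r, arr := a } := fun r a ha0 ha1 =>
      ⟨by simpa using h0, ha0.trans h1, ha1.trans h2⟩
    refine ⟨fun ha => ⟨fun ho => ?_, fun ho => ?_⟩, fun ha => ⟨fun ho => ?_, fun ho => ?_⟩⟩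
    · refine ⟨trivial, hin _ _ (by simp) (by simp), ?_, ?_⟩
      · simpa using (hx.update_asg hk ha).update_own hk ho
      · simpa [Function.update_apply] using key _ _ (fun j => hupd _ (C k) j)
          (fun i => hupd _ (R k) i)
          (by simpa using hk0.ne') (by simpa using hk0.ne')
    · refine ⟨trivial, hin _ _ (by simp) (by simp), ?_, ?_⟩
      · simpa using hx.update_asg hk ha
      · simpa [Function.update_apply] using key _ _ (fun j h => h) (fun i => hupd _ (R k) i) ho
          (by simpa using hk0.ne')
    · refine ⟨trivial, hin _ _ (by simp) (by simp), ?_, ?_⟩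
      · simpa using hx.update_own hk ho
      · simpa [Function.update_apply] using key _ _ (fun j => hupd _ (C k) j) (fun i h => h)
          (by simpa using hk0.ne') ha
    · exact ⟨trivial, hin _ _ rfl rfl, hx, key _ _ (fun _ h => h) (fun _ h => h) ho ha⟩
  · rintro s' ⟨hin, hx, hd⟩
    exact ⟨hin, hx, fun e he => hd e he (by rw [mem_edges] at he; omega)⟩

open Classical in
theorem runs_output (h : HasInput n R C s) :
    Runs (forEdges outputBody) s (2 + (n + 1) * forTime outputBody) (fun s' =>
      ∀ e ∈ edges n, s'.arr 2 (e - 1) = if IsChosen R C (s.arr 8) (s.arr 9) e then 0 else 1) := by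
  refine (runs_forEdges (fun k s' => HasInput n R C s' ∧ s'.arr 8 = s.arr 8 ∧ s'.arr 9 = s.arr 9 ∧
      ∀ e ∈ edges n, e < k →
        s'.arr 2 (e - 1) = if IsChosen R C (s.arr 8) (s.arr 9) e then 0 else 1)
    (fun k s h => h.1.reg_zero) ?_ ?_).mono le_rfl ?_
  · exact ⟨⟨by simpa using h.1, h.2, h.3⟩, rfl, rfl, fun e he h1 => by
      have := edges_pos he; omega⟩
  · rintro k s' hk h5 ⟨⟨h0, h1, h2⟩, h8, h9, hd⟩
    simp only [wp, outputBody, Test.Holds, Expr.eval, rowOf, colOf, Function.update_apply,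
      ↓reduceIte, Nat.reduceEqDiff, h5, h1, h2, h8, h9, sub_add_cancel]
    have key : ∀ z : ℤ, z = (if IsChosen R C (s.arr 8) (s.arr 9) k then 0 else 1) →
        ∀ e ∈ edges n, e < k + 1 → (if e - 1 = k - 1 then z else s'.arr 2 (e - 1)) =
          if IsChosen R C (s.arr 8) (s.arr 9) e then 0 else 1 := by
      intro z hz e he hek
      split_ifs with h1 h2 h2
      · rw [hz, ← (sub_left_inj.1 h1), if_pos h2]
      · rw [hz, ← (sub_left_inj.1 h1), if_neg h2]
      · rw [hd e he (by omega), if_pos h2]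
      · rw [hd e he (by omega), if_neg h2]
    have hin : ∀ (r : ℤ) (f : ℤ → ℤ), HasInput n R C
        { reg := Function.update s'.reg 5 r, arr := Function.update s'.arr 2 f } := fun r f =>
      ⟨by simpa using h0, by simpa using h1, by simpa using h2⟩
    refine ⟨fun h => ⟨trivial, hin _ _, trivial, trivial, ?_⟩,
      fun h => ⟨trivial, hin _ _, trivial, trivial, ?_⟩⟩
    · refine key 1 (if_neg ?_).symm
      rintro (h' | h')
      · exact h.1 h'
      · exact h.2 h'
    · refine key 0 (if_pos ?_).symm
      unfold IsChosen
      tauto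
  · rintro s' ⟨-, -, -, hd⟩
    exact fun e he => hd e he (by rw [mem_edges] at he; omega)

end

/-! ### Free sets and edge covers -/

section

variable {n : ℕ} (c : IntegerConfiguration n)

/-- Edge `k + 1` is the sensor `k`. -/
theorem arrayOf_edge (f : Fin n → ℤ) (k : Fin n) : arrayOf f ((k : ℤ) + 1 - 1) = f k := by
  simp [arrayOf]

theorem exists_index_of_mem_edges {e : ℤ} (he : e ∈ edges n) : ∃ k : Fin n, e = (k : ℤ) + 1 := by
  rw [mem_edges] at he
  exact ⟨⟨(e - 1).toNat, by omega⟩, by simp only; omega⟩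

theorem succ_mem_edges (k : Fin n) : (k : ℤ) + 1 ∈ edges n := by
  rw [mem_edges]; omega

theorem succ_injective : Function.Injective (fun k : Fin n => (k : ℤ) + 1) := by
  intro k l h
  simp only at h
  omega

/-- The sensors that a free set leaves in place still reach every row of a sensor. -/
theorem IntegerConfiguration.IsFreeSet.exists_row {c : IntegerConfiguration n}
    {M : Finset (Fin n)} (h : c.IsFreeSet M) (k : Fin n) : ∃ l ∉ M, c.row l = c.row k := by
  by_contra! hk
  exact (h.2.1 (c.row k) ⟨c.row_mem k, fun l hl => hk l (by simpa using hl)⟩).2 k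
    (Finset.mem_univ k) rfl

theorem IntegerConfiguration.IsFreeSet.exists_col {c : IntegerConfiguration n}
    {M : Finset (Fin n)} (h : c.IsFreeSet M) (k : Fin n) : ∃ l ∉ M, c.col l = c.col k := by
  by_contra! hk
  exact (h.2.2 (c.col k) ⟨c.col_mem k, fun l hl => hk l (by simpa using hl)⟩).2 k
    (Finset.mem_univ k) rfl

/-- A set of sensors is free as soon as the other sensors reach every row and every column: each of
its members then shares its row and its column with a sensor outside the set. -/
theorem IntegerConfiguration.isFreeSet_of_exists {M : Finset (Fin n)}
    (hr : ∀ k, ∃ l ∉ M, c.row l = c.row k) (hc : ∀ k, ∃ l ∉ M, c.col l = c.col k) :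
    c.IsFreeSet M := by
  refine ⟨fun k hk => ⟨?_, ?_⟩, fun i hi => ⟨hi.1, fun k _ hki => ?_⟩,
    fun j hj => ⟨hj.1, fun k _ hkj => ?_⟩⟩
  · obtain ⟨l, hl, h⟩ := hr k
    exact ⟨l, by rintro rfl; exact hl hk, h⟩
  · obtain ⟨l, hl, h⟩ := hc k
    exact ⟨l, by rintro rfl; exact hl hk, h⟩
  · obtain ⟨l, hl, h⟩ := hr k
    exact hi.2 l (by simpa using hl) (h.trans hki)
  · obtain ⟨l, hl, h⟩ := hc k
    exact hj.2 l (by simpa using hl) (h.trans hkj)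

open Classical in
/-- The sensors that are not chosen by an extension of a matching form a maximum free set if some
vertex cover is no larger than the matching. -/
theorem IsExtension.isMaximumFreeSet {R C own₀ asg₀ own asg : ℤ → ℤ} {KR KC : Finset ℤ}
    (hR : ∀ k : Fin n, R (k + 1) = c.row k) (hC : ∀ k : Fin n, C (k + 1) = c.col k)
    (hm : IsMatching n R C own₀ asg₀) (hK : IsCover n R C KR KC)
    (hKm : KR.card + KC.card ≤ matchingSize n C own₀)
    (hx : IsExtension n R C own₀ asg₀ own asg)
    (hall : ∀ e ∈ edges n, own (C e) ≠ 0 ∧ asg (R e) ≠ 0) :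
    c.IsMaximumFreeSet (Finset.univ.filter fun k : Fin n => ¬ IsChosen R C own asg (k + 1)) := by
  set M := Finset.univ.filter fun k : Fin n => ¬ IsChosen R C own asg (k + 1)
  have hcard : ∀ T : Finset (Fin n), (T.image fun k : Fin n => (k : ℤ) + 1).card = T.card :=
    fun T => Finset.card_image_of_injective _ succ_injective
  refine ⟨c.isFreeSet_of_exists (fun k => ?_) (fun k => ?_), fun M' hM' => ?_⟩
  · obtain ⟨he, hRe⟩ := hx.asg_spec _ (hall _ (succ_mem_edges k)).2
    obtain ⟨l, hl⟩ := exists_index_of_mem_edges he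
    refine ⟨l, ?_, ?_⟩
    · simp only [M, Finset.mem_filter, Finset.mem_univ, true_and, not_not]
      right
      rw [← hl, hRe]
    · rw [← hR, ← hR, ← hl, hRe]
  · obtain ⟨he, hCe⟩ := hx.own_spec _ (hall _ (succ_mem_edges k)).1
    obtain ⟨l, hl⟩ := exists_index_of_mem_edges he
    refine ⟨l, ?_, ?_⟩
    · simp only [M, Finset.mem_filter, Finset.mem_univ, true_and, not_not]
      left
      rw [← hl, hCe]
    · rw [← hC, ← hC, ← hl, hCe]
  · have h1 := hx.card_chosen_add_le hm
    have h2 : Mᶜ.card = ((edges n).filter (IsChosen R C own asg)).card := by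
      rw [← hcard]
      congr 1
      ext e
      simp only [M, Finset.mem_image, Finset.mem_compl, Finset.mem_filter, Finset.mem_univ,
        true_and, not_not]
      constructor
      · rintro ⟨k, hk, rfl⟩
        exact ⟨succ_mem_edges k, hk⟩
      · rintro ⟨he, hc⟩
        obtain ⟨k, rfl⟩ := exists_index_of_mem_edges he
        exact ⟨k, hc, rfl⟩
    have h3 := hK.card_add_card_le (F := M'ᶜ.image fun k : Fin n => (k : ℤ) + 1) ?_ ?_ ?_
    · rw [hcard] at h3
      rw [Finset.card_compl] at h2 h3
      have := M.card_le_univ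
      have := M'.card_le_univ
      omega
    · intro e he
      obtain ⟨k, -, rfl⟩ := Finset.mem_image.1 he
      exact succ_mem_edges k
    · intro i hi
      obtain ⟨e, he, rfl⟩ := Finset.mem_image.1 hi
      obtain ⟨k, rfl⟩ := exists_index_of_mem_edges he
      obtain ⟨l, hl, hlk⟩ := hM'.exists_row k
      rw [hR, ← hlk, ← hR]
      exact Finset.mem_image_of_mem _
        (Finset.mem_image_of_mem (fun k : Fin n => (k : ℤ) + 1) (by simpa using hl))
    · intro i hi
      obtain ⟨e, he, rfl⟩ := Finset.mem_image.1 hi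
      obtain ⟨k, rfl⟩ := exists_index_of_mem_edges he
      obtain ⟨l, hl, hlk⟩ := hM'.exists_col k
      rw [hC, ← hlk, ← hC]
      exact Finset.mem_image_of_mem _
        (Finset.mem_image_of_mem (fun k : Fin n => (k : ℤ) + 1) (by simpa using hl))

/-! ### The run of the whole program -/

theorem Runs.seq_mul {p q : Program} {s : Store} {K₁ K₂ N : ℕ} {Q₁ Q₂ : Store → Prop}
    (h₁ : Runs p s (K₁ * N) Q₁) (h₂ : ∀ s', Q₁ s' → Runs q s' (K₂ * N) Q₂) :
    Runs (.seq p q) s ((K₁ + K₂) * N) Q₂ := by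
  rw [Nat.add_mul]
  exact h₁.seq h₂

/-- All parts of the program run in time `O(n * L)`, where `L` is the least integer with
`n ≤ L * L`. -/
theorem exists_runs_freeSetProgram : ∃ K : ℕ, ∀ (n : ℕ) (c : IntegerConfiguration n),
    ∃ L : ℕ, (L = 0 ∨ (L - 1) * (L - 1) < n) ∧
      Runs freeSetProgram (inputStore c) (K * (n * L))
        (fun s => ∃ M, OutputIs s M ∧ c.IsMaximumFreeSet M) := by
  classical
  refine ⟨2 * (5 + maxTime rootBody) + ((2 + 2 * forTime listBody) +
    ((maxTime startProgram + 5 * (4 + maxTime auctionBody)) +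
    ((2 + 3 * (8 + 2 * forTime resetBody + maxTime startProgram + 4 * (4 + maxTime searchBody))) +
    ((2 + 2 * forTime extendBody) + (2 + 2 * forTime outputBody))))), fun n c => ?_⟩
  have hn : 0 < n := lt_of_lt_of_le c.a_pos ((le_max_left _ _).trans c.enough)
  set R : ℤ → ℤ := fun e => arrayOf c.row (e - 1) with hR
  set C : ℤ → ℤ := fun e => arrayOf c.col (e - 1) with hC
  have hin : HasInput n R C (inputStore c) :=
    ⟨rfl, by funext z; simp [inputStore, hR], by funext z; simp [inputStore, hC]⟩
  -- `L` is determined by the run of `rootProgram`, which therefore has to be unpacked first.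
  obtain ⟨s₁, t₁, e₁, ht₁, hin₁, ha₁, L, h6₁, hL, hL'⟩ := runs_rootProgram hin rfl rfl
  have hL0 : 0 < L := Nat.pos_of_ne_zero (by rintro rfl; omega)
  refine ⟨L, hL', ?_⟩
  have hnN : n ≤ n * L := Nat.le_mul_of_pos_right n hL0
  have hLN : L ≤ n * L := Nat.le_mul_of_pos_left L hn
  have hfor : ∀ w : ℕ, (n + 1) * w ≤ 2 * w * (n * L) := fun w => by
    nlinarith [Nat.mul_le_mul_right w (show n + 1 ≤ 2 * (n * L) by omega)]
  have hfor' : ∀ w : ℕ, 2 + (n + 1) * w ≤ (2 + 2 * w) * (n * L) := fun w => by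
    rw [Nat.add_mul 2]
    exact Nat.add_le_add (by omega) (hfor w)
  have h₁ : Runs rootProgram (inputStore c) (2 * (5 + maxTime rootBody) * (n * L))
      (fun s => s = s₁) := ⟨s₁, t₁, e₁, ht₁.trans (hfor _), rfl⟩
  refine h₁.seq_mul fun s hs => ?_
  subst hs
  refine Runs.seq_mul ((runs_lists hin₁ (by rw [ha₁]; rfl) (by rw [ha₁]; rfl)).mono (hfor' _)
    fun _ h => h) fun s₂ ⟨hin₂, hl₂, hc₂, h6₂, hA₂⟩ => ?_
  have hz : ∀ A, 5 < A → s₂.arr A = fun _ => 0 := fun A hA => by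
    rw [hA₂ A hA, ha₁]
    obtain ⟨B, rfl⟩ : ∃ B, A = B + 2 := ⟨A - 2, by omega⟩
    rfl
  refine Runs.seq_mul ((runs_auctionProgram hn hL hin₂ hl₂ hc₂ (h6₂.trans h6₁) hz).mono ?_
    fun _ h => h) fun s₃ ⟨hin₃, hl₃, hcur₃, hm₃, hmax₃⟩ => ?_
  · generalize maxTime startProgram = a
    generalize 4 + maxTime auctionBody = w
    rw [Nat.add_mul a]
    refine Nat.add_le_add (Nat.le_mul_of_pos_right a (by omega)) ?_
    nlinarith [Nat.mul_le_mul_right w (show n * (2 * L + 2) + 1 ≤ 5 * (n * L) by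
      rw [Nat.mul_add, Nat.mul_left_comm]; omega)]
  refine Runs.seq_mul ((runs_matchingProgram hn hin₃ hl₃ hcur₃ hm₃ hmax₃).mono ?_
    fun _ h => h) fun s₄ ⟨hin₄, hm₄, KR, KC, hK, hKm⟩ => ?_
  · have hround : 4 + roundTime n ≤
        (8 + 2 * forTime resetBody + maxTime startProgram + 4 * (4 + maxTime searchBody)) * n := by
      unfold roundTime
      generalize forTime resetBody = a
      generalize maxTime startProgram = b
      generalize 4 + maxTime searchBody = d
      have h1 : a * 1 ≤ a * n := Nat.mul_le_mul_left a hn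
      have h2 : b * 1 ≤ b * n := Nat.mul_le_mul_left b hn
      have h3 : d * 1 ≤ d * n := Nat.mul_le_mul_left d hn
      nlinarith
    rw [Nat.add_mul 2]
    refine Nat.add_le_add (by omega)
      ((Nat.mul_le_mul (show L + 1 + 1 ≤ 3 * L by omega) hround).trans (le_of_eq ?_))
    ring
  refine Runs.seq_mul ((runs_extend hin₄ hm₄).mono (hfor' _) fun _ h => h)
    fun s₅ ⟨hin₅, hx₅, hall₅⟩ => ?_
  refine (runs_output hin₅).mono (hfor' _) fun s₆ hout => ?_
  refine ⟨_, fun k => ?_, hx₅.isMaximumFreeSet c (arrayOf_edge _) (arrayOf_edge _) hm₄ hK hKm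
    hall₅⟩
  have := hout _ (succ_mem_edges k)
  rw [add_sub_cancel_right] at this
  rw [this]
  by_cases hch : IsChosen R C (s₅.arr 8) (s₅.arr 9) (k + 1) <;> simp [hch]

end
end WeakBarrier

theorem mainTheorem5 :
    ∃ (P : WeakBarrier.Program) (C : ℝ),
      ∀ (n : ℕ) (c : WeakBarrier.IntegerConfiguration n),
        ∃ (s : WeakBarrier.Store) (t : ℕ) (M : Finset (Fin n)),
          WeakBarrier.Exec P (WeakBarrier.inputStore c) s t ∧
          WeakBarrier.OutputIs s M ∧
          c.IsMaximumFreeSet M ∧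
          (t : ℝ) ≤ C * (n : ℝ) ^ ((3 : ℝ) / 2) := by
  obtain ⟨K, hK⟩ := WeakBarrier.exists_runs_freeSetProgram
  refine ⟨WeakBarrier.freeSetProgram, 2 * K, fun n c => ?_⟩
  obtain ⟨L, hL, s, t, he, ht, M, hout, hM⟩ := hK n c
  refine ⟨s, t, M, he, hout, hM, ?_⟩
  have hn : 1 ≤ n := lt_of_lt_of_le c.a_pos ((le_max_left _ _).trans c.enough)
  have hn' : (1 : ℝ) ≤ n := by exact_mod_cast hn
  have hs : (1 : ℝ) ≤ √(n : ℝ) := Real.one_le_sqrt.2 hn'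
  have hL2 : (L : ℝ) ≤ 2 * √(n : ℝ) := by
    rcases hL with rfl | hL
    · push_cast; linarith
    rcases Nat.eq_zero_or_pos L with rfl | hL0
    · push_cast; linarith
    have h1 : ((L : ℝ) - 1) ^ 2 ≤ n := by
      have h2 : (((L - 1) * (L - 1) : ℕ) : ℝ) ≤ n := by exact_mod_cast hL.le
      rw [Nat.cast_mul, Nat.cast_sub hL0] at h2
      simpa [sq] using h2
    have := Real.le_sqrt_of_sq_le h1
    linarith
  have hpow : (n : ℝ) ^ ((3 : ℝ) / 2) = n * √(n : ℝ) := by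
    rw [show (3 : ℝ) / 2 = 1 + 1 / 2 by norm_num, Real.rpow_add (by linarith), Real.rpow_one,
      Real.sqrt_eq_rpow]
  calc (t : ℝ) ≤ (K * (n * L) : ℕ) := by exact_mod_cast ht
    _ = K * (n * L) := by push_cast; ring
    _ ≤ K * (n * (2 * √(n : ℝ))) := by gcongr
    _ = 2 * K * (n : ℝ) ^ ((3 : ℝ) / 2) := by rw [hpow]; ring
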